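/- Let $F$ be a field and $k$ an integer; $H_k$ denotes singular homology with coefficients in $F$ (zero for $k<0$). For a compact topological space $X$, a continuous $f\colon X\to\mathbb R$ and $a<b$, put $X_a=\{x\in X: f(x)\le a\}$ and let $\beta_f(a,b)$ be the rank of the map $H_k(X_a)\to H_k(X_b)$ induced by inclusion. Call $f$ tame if $\beta_f(a,b)<\infty$ for all $a<b$. The persistence diagram $\mathrm{dgm}_k(f)$ of a tame $f$ is the multiset of points of $\{(a,b):a<b\}\cup\{(a,\infty):a\in\mathbb R\}\cup\{\Delta\}$ in which $(a,b)$ has multiplicity $$\min_{\varepsilon>0,\ a+\varepsilon<b-\varepsilon}\bigl(\beta_f(a+\varepsilon,b-\varepsilon)-\beta_f(a-\varepsilon,b-\varepsilon)-\beta_f(a+\varepsilon,b+\varepsilon)+\beta_f(a-\varepsilon,b+\varepsilon)\bigr),$$ $(a,\infty)$ has multiplicity $\min_{\varepsilon>0,\ c>a+\varepsilon}\bigl(\beta_f(a+\varepsilon,c)-\beta_f(a-\varepsilon,c)\bigr)$, and $\Delta$ has (countably) infinite multiplicity. Put $d\bigl((a,b),(a',b')\bigr)=\min\{\max\{|a-a'|,|b-b'|\},\max\{\frac{b-a}2,\frac{b'-a'}2\}\}$,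 $d\bigl((a,\infty),(a',\infty)\bigr)=|a-a'|$, $d\bigl((a,b),\Delta\bigr)=d\bigl(\Delta,(a,b)\bigr)=\frac{b-a}2$, $d(\Delta,\Delta)=0$, and $d=\infty$ in all other cases. The bottleneck distance is $d_B(D,E)=\inf_\sigma\sup_{p\in D}d(p,\sigma(p))$, where $\sigma$ ranges over the multiset bijections $D\to E$. For a continuous $\boldsymbol\varphi=(\varphi_1,\varphi_2)\colon X\to\mathbb R^2$ and $t\in[0,1]$ put $\boldsymbol\varphi^t=(1-t)\varphi_1+t\varphi_2$, and call $\boldsymbol\varphi$ admissible if $\boldsymbol\varphi^t$ is tame for every $t\in[0,1]$. Then, for every compact topological space $X$, the convex matching distance $$\mathrm{cmd}_k(\boldsymbol\varphi,\boldsymbol\psi)=\max_{t\in[0,1]}d_B\bigl(\mathrm{dgm}_k(\boldsymbol\varphi^t),\mathrm{dgm}_k(\boldsymbol\psi^t)\bigr)$$ is well defined for all admissible $\boldsymbol\varphi,\boldsymbol\psi\colon X\to\mathbb R^2$: the bottleneck distances are finite for every $t\in[0,1]$ and the maximum is attained. Moreover $\mathrm{cmd}_k$ is a pseudo-metric on the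 admissible functions on $X$: $\mathrm{cmd}_k(\boldsymbol\varphi,\boldsymbol\psi)\ge0$, $\mathrm{cmd}_k(\boldsymbol\varphi,\boldsymbol\psi)=\mathrm{cmd}_k(\boldsymbol\psi,\boldsymbol\varphi)$, $\mathrm{cmd}_k(\boldsymbol\varphi,\boldsymbol\varphi)=0$ and $\mathrm{cmd}_k(\boldsymbol\varphi,\boldsymbol\psi)\le\mathrm{cmd}_k(\boldsymbol\varphi,\boldsymbol\xi)+\mathrm{cmd}_k(\boldsymbol\xi,\boldsymbol\psi)$. It is not a metric in general: there are a compact space $X$ and admissible $\boldsymbol\varphi\ne\boldsymbol\psi$ on $X$ with $\mathrm{cmd}_k(\boldsymbol\varphi,\boldsymbol\psi)=0$. -/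

import Mathlib

open scoped ENNReal

universe u v

namespace ConvexMatching

open CategoryTheory

/-- Singular homology in degree `k : ℤ` with coefficients in the field `F`, as a functor to
`F`-vector spaces. It is zero in negative degrees. -/
noncomputable def homologyFunctor (F : Type v) [Field F] (k : ℤ) :
    TopCat.{u} ⥤ ModuleCat.{max u v} F :=
  match k with
  | Int.ofNat n =>
      (AlgebraicTopology.singularHomologyFunctor (ModuleCat.{max u v} F) n).obj
        (ModuleCat.of F (ULift.{max u v} F))
  | Int.negSucc _ => (Functor.const _).obj (ModuleCat.of F PUnit)

section Persistence

variable {X : Type u} [TopologicalSpace X]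

/-- The sublevel set `X_a = {x | f x ≤ a}`, as a topological space. -/
def sublevel (f : C(X, ℝ)) (a : ℝ) : TopCat.{u} := TopCat.of {x : X // f x ≤ a}

/-- The inclusion `X_a ⊆ X_b` of sublevel sets, for `a ≤ b`. -/
def sublevelIncl (f : C(X, ℝ)) {a b : ℝ} (hab : a ≤ b) : sublevel f a ⟶ sublevel f b :=
  TopCat.ofHom
    { toFun := fun x => ⟨x.1, x.2.trans hab⟩
      continuous_toFun := continuous_subtype_val.subtype_mk _ }

/-- The `k`-th persistent homology space of `f` at `(a, b)`: the image of the map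
`H_k(X_a) → H_k(X_b)` induced by inclusion. -/
noncomputable def persistentHomology (F : Type v) [Field F] (k : ℤ) (f : C(X, ℝ)) {a b : ℝ}
    (hab : a ≤ b) : Submodule F ((homologyFunctor.{u, v} F k).obj (sublevel f b)) :=
  LinearMap.range ((homologyFunctor.{u, v} F k).map (sublevelIncl f hab)).hom

/-- The `k`-th persistent Betti numbers of `f` at all `(a, b)` with `a < b` are finite. -/
def IsTame (F : Type v) [Field F] (k : ℤ) (f : C(X, ℝ)) : Prop :=
  ∀ (a b : ℝ) (hab : a < b), Module.Finite F (persistentHomology F k f hab.le)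

/-- The `k`-th persistent Betti number of `f` at `(a, b)`. It is only used for `a < b`. -/
noncomputable def betti (F : Type v) [Field F] (k : ℤ) (f : C(X, ℝ)) (a b : ℝ) : ℕ :=
  if hab : a ≤ b then Module.finrank F (persistentHomology F k f hab) else 0

end Persistence

/-- The set `Δ⁺ ∪ {(a, ∞) | a ∈ ℝ} ∪ {Δ}` in which persistence diagrams live. -/
inductive Point where
  /-- The point `(a, b)` of `Δ⁺`, where `a < b`. -/
  | proper (a b : ℝ) (hab : a < b)
  /-- The point `(a, ∞)`. -/
  | essential (a : ℝ)
  /-- The diagonal `Δ`, seen as a single point. -/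
  | diag

/-- The extended metric on `Point`. -/
noncomputable def Point.d : Point → Point → ℝ≥0∞
  | .proper a b _, .proper a' b' _ =>
      ENNReal.ofReal (min (max |a - a'| |b - b'|) (max ((b - a) / 2) ((b' - a') / 2)))
  | .essential a, .essential a' => ENNReal.ofReal |a - a'|
  | .proper a b _, .diag => ENNReal.ofReal ((b - a) / 2)
  | .diag, .proper a b _ => ENNReal.ofReal ((b - a) / 2)
  | .diag, .diag => 0
  | _, _ => ⊤

/-- A multiset of points, given by its multiplicity function. -/
abbrev Diagram := Point → ℕ∞

/-- The elements of a multiset of points, a point of multiplicity `m` being listed `m` times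
(countably many times if `m = ∞`). -/
abbrev Diagram.Elem (D : Diagram) : Type := {x : Point × ℕ // (x.2 : ℕ∞) < D x.1}

/-- The bottleneck distance between two multisets of points: the infimum over all multiset
bijections `σ` of the supremum of `d (p, σ p)`. -/
noncomputable def bottleneck (D E : Diagram) : ℝ≥0∞ :=
  ⨅ σ : D.Elem ≃ E.Elem, ⨆ p : D.Elem, Point.d p.1.1 (σ p).1.1

section Persistence

variable {X : Type u} [TopologicalSpace X]

/-- Multiplicity of `(a, b) ∈ Δ⁺`: the minimum, over `ε > 0` with `a + ε < b - ε`, of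
`β(a + ε, b - ε) - β(a - ε, b - ε) - β(a + ε, b + ε) + β(a - ε, b + ε)`. -/
noncomputable def properMult (F : Type v) [Field F] (k : ℤ) (f : C(X, ℝ)) (a b : ℝ) : ℕ :=
  sInf {m : ℕ | ∃ ε : ℝ, 0 < ε ∧ a + ε < b - ε ∧
    (m : ℤ) = (betti F k f (a + ε) (b - ε) : ℤ) - betti F k f (a - ε) (b - ε)
      - betti F k f (a + ε) (b + ε) + betti F k f (a - ε) (b + ε)}

/-- Multiplicity of `(a, ∞)`: the minimum, over `ε > 0` and `c > a + ε`, of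
`β(a + ε, c) - β(a - ε, c)`. -/
noncomputable def essentialMult (F : Type v) [Field F] (k : ℤ) (f : C(X, ℝ)) (a : ℝ) : ℕ :=
  sInf {m : ℕ | ∃ ε c : ℝ, 0 < ε ∧ a + ε < c ∧
    (m : ℤ) = (betti F k f (a + ε) c : ℤ) - betti F k f (a - ε) c}

/-- The `k`-th persistence diagram of `f`, where `Δ` has infinite multiplicity. -/
noncomputable def dgm (F : Type v) [Field F] (k : ℤ) (f : C(X, ℝ)) : Diagram
  | .proper a b _ => properMult F k f a b
  | .essential a => essentialMult F k f a
  | .diag => ⊤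

/-- The function `φ^t = (1 - t) φ₁ + t φ₂`. -/
def convexComb (φ : C(X, ℝ × ℝ)) (t : ℝ) : C(X, ℝ) where
  toFun x := (1 - t) * (φ x).1 + t * (φ x).2
  continuous_toFun := by fun_prop

/-- All convex combinations `φ^t`, `t ∈ [0, 1]`, have finite `k`-th persistent Betti numbers, so
that their `k`-th persistence diagrams are defined. -/
def IsAdmissible (F : Type v) [Field F] (k : ℤ) (φ : C(X, ℝ × ℝ)) : Prop :=
  ∀ t ∈ Set.Icc (0 : ℝ) 1, IsTame F k (convexComb φ t)

/-- The bottleneck distance between the `k`-th persistence diagrams of `φ^t` and `ψ^t`. -/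
noncomputable def sliceDist (F : Type v) [Field F] (k : ℤ) (φ ψ : C(X, ℝ × ℝ)) (t : ℝ) : ℝ≥0∞ :=
  bottleneck (dgm F k (convexComb φ t)) (dgm F k (convexComb ψ t))

/-- The convex matching distance `cmd_k`. -/
noncomputable def cmd (F : Type v) [Field F] (k : ℤ) (φ ψ : C(X, ℝ × ℝ)) : ℝ :=
  sSup ((fun t : ℝ => (sliceDist F k φ ψ t).toReal) '' Set.Icc 0 1)

end Persistence

end ConvexMatching

/-!
The substance is the stability of persistence diagrams: if `|f - g| ≤ δ` everywhere, the diagrams of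
`f` and `g` are at bottleneck distance at most `δ`. By the Frobenius rank inequality, the ranks of
`H(A a) → H(B b)`, for chains `A` and `B` of subspaces, satisfy the box inequality, so that they
define multiplicities of bars `(a, b)`. Let `r'` be the rank function of the maps from the sublevel
sets of `f` to those of `g`, shifted by `δ`. In each row, that is for each birth `a`, the increments
of `r'` are at most those of the rank function of `f`, and at least those of its shift by `2δ`.
Listing the bars in a row by decreasing death, one therefore gets the bars of `r'` from those of `f`
by lowering the deaths by at most `2δ`, only bars of length at most `2δ` being lost. The columns of
`r'` are related to `g` in the same way, and the composite of the two matchings, centred, moves the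
endpoints of the bars by at most `δ`.

Stability makes the bottleneck distance of the diagrams of `φ^t` and `ψ^t` finite and continuous in
`t`, hence the maximum is attained; `cmd` inherits being a pseudo-metric from the bottleneck
distance. Swapping the points of a two-point space changes a function but not its diagrams.
-/

namespace ConvexMatching

open CategoryTheory Filter Set Topology

section Jump

theorem eventually_eq_sInf_image {α : Type*} {l : Filter α} {F : α → ℕ} {S : Set α} (hS : S ∈ l)
    (hF : ∀ x ∈ S, ∀ᶠ y in l, F y ≤ F x) : ∀ᶠ y in l, F y = sInf (F '' S) := by
  rcases l.eq_or_neBot with rfl | _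
  · exact eventually_bot
  · obtain ⟨x, hx, hmin⟩ := Nat.sInf_mem ((Filter.nonempty_of_mem hS).image F)
    filter_upwards [hF x hx, hS] with y hyx hyS
    exact (hyx.trans_eq hmin).antisymm (Nat.sInf_le (mem_image_of_mem F hyS))

theorem eventually_eq_liminf {α : Type*} {l : Filter α} {F : α → ℕ}
    (hF : ∀ᶠ x in l, ∀ᶠ y in l, F y ≤ F x) : ∀ᶠ y in l, F y = liminf F l := by
  rcases l.eq_or_neBot with rfl | _
  · exact eventually_bot
  · have h := eventually_eq_sInf_image hF fun _ => id
    rwa [liminf_congr h, liminf_const]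

variable {L : Type*} [CompleteLinearOrder L] [TopologicalSpace L]

/-- The filter of pairs `(a₁, a₂)` approaching `a` with `a₁ < a < a₂`; at the extreme points of `L`
the inequalities are relaxed to `a₁ = ⊥` and `a₂ = ⊤`. -/
def around (a : L) : Filter (L × L) := 𝓝[insert ⊥ (Iio a)] a ×ˢ 𝓝[insert ⊤ (Ioi a)] a

theorem tendsto_fst_around (a : L) : Tendsto Prod.fst (around a) (𝓝 a) :=
  tendsto_fst.mono_right nhdsWithin_le_nhds

theorem tendsto_snd_around (a : L) : Tendsto Prod.snd (around a) (𝓝 a) :=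
  tendsto_snd.mono_right nhdsWithin_le_nhds

theorem eventually_mem_around (a : L) :
    ∀ᶠ p in around a, p.1 ∈ insert ⊥ (Iio a) ∧ p.2 ∈ insert ⊤ (Ioi a) :=
  (tendsto_fst.eventually self_mem_nhdsWithin).and (tendsto_snd.eventually self_mem_nhdsWithin)

theorem eventually_mem_Icc_around (a : L) : ∀ᶠ p in around a, a ∈ Icc p.1 p.2 :=
  (eventually_mem_around a).mono fun _ hp =>
    ⟨hp.1.elim (· ▸ bot_le) (·.le), hp.2.elim (· ▸ le_top) (·.le)⟩

variable [OrderTopology L]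

theorem eventually_nested_around {a : L} {p : L × L}
    (hp : p.1 ∈ insert ⊥ (Iio a) ∧ p.2 ∈ insert ⊤ (Ioi a)) :
    ∀ᶠ q in around a, p.1 ≤ q.1 ∧ q.1 ≤ a ∧ a ≤ q.2 ∧ q.2 ≤ p.2 := by
  have lower : ∀ᶠ q in around a, p.1 ≤ q.1 := hp.1.elim (fun h => h ▸ .of_forall fun _ => bot_le)
    fun h => ((tendsto_fst_around a).eventually_const_lt h).mono fun _ => le_of_lt
  have upper : ∀ᶠ q in around a, q.2 ≤ p.2 := hp.2.elim (fun h => h ▸ .of_forall fun _ => le_top)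
    fun h => ((tendsto_snd_around a).eventually_lt_const h).mono fun _ => le_of_lt
  filter_upwards [lower, eventually_mem_Icc_around a, upper] with q h₁ h₂ h₃
  exact ⟨h₁, h₂.1, h₂.2, h₃⟩

instance [DenselyOrdered L] (a : L) : (around a).NeBot := by
  have below : (𝓝[insert ⊥ (Iio a)] a).NeBot := by
    rcases eq_bot_or_bot_lt a with rfl | ha
    · exact nhdsWithin_neBot_of_mem (mem_insert _ _)
    · have := nhdsLT_neBot_of_exists_lt ⟨_, ha⟩
      exact NeBot.mono this (nhdsWithin_mono _ (subset_insert _ _))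
  have above : (𝓝[insert ⊤ (Ioi a)] a).NeBot := by
    rcases eq_top_or_lt_top a with rfl | ha
    · exact nhdsWithin_neBot_of_mem (mem_insert _ _)
    · have := nhdsGT_neBot_of_exists_gt ⟨_, ha⟩
      exact NeBot.mono this (nhdsWithin_mono _ (subset_insert _ _))
  exact prod.instNeBot

/-- The jump `g (a+) - g (a-)` at `a` of a function `g` with natural values. -/
noncomputable def jump (g : L → ℕ) (a : L) : ℕ := liminf (fun p => g p.2 - g p.1) (around a)

theorem eventually_eq_add_jump {g : L → ℕ} {a d : L} (hg : MonotoneOn g (Iio d)) (had : a < d) :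
    ∀ᶠ p in around a, g p.2 = g p.1 + jump g a := by
  have small : ∀ᶠ p in around a, p.2 < d := (tendsto_snd_around a).eventually_lt_const had
  have stable : ∀ᶠ p in around a, g p.2 - g p.1 = jump g a := by
    refine eventually_eq_liminf ?_
    filter_upwards [eventually_mem_around a, small] with p hp hpd
    filter_upwards [eventually_nested_around hp] with q ⟨h₁, h₂, _, h₄⟩
    have hqd : q.2 < d := h₄.trans_lt hpd
    exact tsub_le_tsub (hg hqd hpd h₄)
      (hg (h₁.trans_lt (h₂.trans_lt had)) (h₂.trans_lt had) h₁)
  filter_upwards [stable, small, eventually_mem_Icc_around a] with p hjump hpd hpa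
  have := hg ((hpa.1.trans hpa.2).trans_lt hpd) hpd (hpa.1.trans hpa.2)
  omega

theorem jump_le_jump [DenselyOrdered L] {g g' : L → ℕ} {a d d' : L} (hg : MonotoneOn g (Iio d))
    (hg' : MonotoneOn g' (Iio d')) (had : a < d) (had' : a < d')
    (h : ∀ a₁ a₂, a₁ ≤ a₂ → a₂ < d → a₂ < d' → g a₂ + g' a₁ ≤ g' a₂ + g a₁) :
    jump g a ≤ jump g' a := by
  obtain ⟨p, hp, hp', hpa, hpd⟩ := ((eventually_eq_add_jump hg had).and
    ((eventually_eq_add_jump hg' had').and ((eventually_mem_Icc_around a).and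
    ((tendsto_snd_around a).eventually_lt_const (lt_min had had'))))).exists
  have := h p.1 p.2 (hpa.1.trans hpa.2) (hpd.trans_le (min_le_left _ _))
    (hpd.trans_le (min_le_right _ _))
  omega

end Jump

section RankFunction

variable {L : Type*} [CompleteLinearOrder L]

/-- A rank function: for `a < b`, `r a b` stands for the number of bars that are born before `a` and
die after `b`. -/
structure IsRankFunction (r : L → L → ℕ) : Prop where
  bot : ∀ b, r ⊥ b = 0
  top : ∀ a, r a ⊤ = 0
  box : ∀ {a₁ a₂ b₁ b₂ : L}, a₁ ≤ a₂ → a₂ < b₁ → b₁ ≤ b₂ →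
    r a₂ b₂ + r a₁ b₁ ≤ r a₂ b₁ + r a₁ b₂

theorem IsRankFunction.monotoneOn {r : L → L → ℕ} (hr : IsRankFunction r) (d : L) :
    MonotoneOn (r · d) (Iio d) := fun a₁ _ a₂ ha₂ h => by
  have := hr.box h ha₂ le_top
  simpa only [hr.top, zero_add, add_zero] using this

/-- The number of bars of a rank function that are born in `[p.1, p.2]` and die in `[q.1, q.2]`. -/
def boxCount (r : L → L → ℕ) (p q : L × L) : ℕ :=
  (r p.2 q.1 + r p.1 q.2) - (r p.2 q.2 + r p.1 q.1)

theorem IsRankFunction.boxCount_le_boxCount {r : L → L → ℕ} (hr : IsRankFunction r)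
    {a₁ a₂ b₁ b₂ a₁' a₂' b₁' b₂' : L} (h₁ : a₁ ≤ a₁') (h₂ : a₁' ≤ a₂') (h₃ : a₂' ≤ a₂)
    (h₄ : a₂ < b₁) (h₅ : b₁ ≤ b₁') (h₆ : b₁' ≤ b₂') (h₇ : b₂' ≤ b₂) :
    boxCount r (a₁', a₂') (b₁', b₂') ≤ boxCount r (a₁, a₂) (b₁, b₂) := by
  have left := hr.box h₁ ((h₂.trans h₃).trans_lt h₄) (h₅.trans (h₆.trans h₇))
  have right := hr.box h₃ h₄ (h₅.trans (h₆.trans h₇))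
  have lower := hr.box h₂ (h₃.trans_lt h₄) h₅
  have upper := hr.box h₂ (h₃.trans_lt (h₄.trans_le (h₅.trans h₆))) h₇
  have inner := hr.box h₂ (h₃.trans_lt (h₄.trans_le h₅)) h₆
  simp only [boxCount]
  omega

theorem IsRankFunction.shift {r : L → L → ℕ} (hr : IsRankFunction r) (s : L ≃o L)
    (hs : ∀ x, x ≤ s x) : IsRankFunction fun a d => r a (s d) where
  bot _ := hr.bot _
  top _ := by simp only [OrderIso.map_top, hr.top]
  box h₁ h₂ h₃ := hr.box h₁ (h₂.trans_le (hs _)) (s.monotone h₃)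

theorem IsRankFunction.comp_orderIso {r : L → L → ℕ} (hr : IsRankFunction r) (e : L ≃o L) :
    IsRankFunction fun a b => r (e a) (e b) where
  bot _ := by simp only [OrderIso.map_bot, hr.bot]
  top _ := by simp only [OrderIso.map_top, hr.top]
  box h₁ h₂ h₃ := hr.box (e.monotone h₁) (e.strictMono h₂) (e.monotone h₃)

open OrderDual in
/-- The rank function with births and deaths exchanged. -/
def dualRank (r : L → L → ℕ) : Lᵒᵈ → Lᵒᵈ → ℕ := fun x y => r (ofDual y) (ofDual x)

theorem IsRankFunction.dual {r : L → L → ℕ} (hr : IsRankFunction r) :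
    IsRankFunction (dualRank r) where
  bot _ := hr.top _
  top _ := hr.bot _
  box h₁ h₂ h₃ := by
    have := hr.box (OrderDual.ofDual_le_ofDual.2 h₃) (OrderDual.ofDual_lt_ofDual.2 h₂)
      (OrderDual.ofDual_le_ofDual.2 h₁)
    unfold dualRank
    omega

variable [TopologicalSpace L]

/-- The number of bars with birth `a` and death `b`. -/
noncomputable def mult (r : L → L → ℕ) (a b : L) : ℕ :=
  liminf (fun x => boxCount r x.1 x.2) (around a ×ˢ around b)

/-- The number of bars with birth `a` that die after `d`. -/
noncomputable def rowCount (r : L → L → ℕ) (a d : L) : ℕ := jump (r · d) a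

/-- The death of the `n`-th bar with birth `a`, in the order of decreasing deaths. -/
noncomputable def rowDeath (r : L → L → ℕ) (a : L) (n : ℕ) : L :=
  sSup {d | a < d ∧ n < rowCount r a d}

theorem rowCount_le {r : L → L → ℕ} {a d : L} {n : ℕ} (had : a < d) (hd : rowDeath r a n < d) :
    rowCount r a d ≤ n :=
  not_lt.1 fun hn => (le_sSup (show d ∈ {d | a < d ∧ n < rowCount r a d} from ⟨had, hn⟩)).not_gt hd

variable [OrderTopology L]

theorem IsRankFunction.eventually_boxCount_le {r : L → L → ℕ} (hr : IsRankFunction r) {a b : L}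
    {p q : L × L} (hp : p.1 ∈ insert ⊥ (Iio a) ∧ p.2 ∈ insert ⊤ (Ioi a))
    (hq : q.1 ∈ insert ⊥ (Iio b) ∧ q.2 ∈ insert ⊤ (Ioi b)) (hpq : p.2 < q.1) :
    ∀ᶠ x in around a ×ˢ around b, boxCount r x.1 x.2 ≤ boxCount r p q := by
  filter_upwards [(eventually_nested_around hp).prod_mk (eventually_nested_around hq)]
    with x ⟨⟨h₁, h₂, h₃, h₄⟩, h₅, h₆, h₇, h₈⟩
  exact hr.boxCount_le_boxCount h₁ (h₂.trans h₃) h₄ hpq h₅ (h₆.trans h₇) h₈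

variable [DenselyOrdered L]

theorem eventually_around_lt_around {a b : L} (hab : a < b) :
    ∀ᶠ x in around a ×ˢ around b, x.1.2 < x.2.1 := by
  obtain ⟨c, hac, hcb⟩ := exists_between hab
  exact (((tendsto_snd_around a).eventually_lt_const hac).prod_mk
    ((tendsto_fst_around b).eventually_const_lt hcb)).mono fun _ h => h.1.trans h.2

theorem IsRankFunction.eventually_boxCount_eq {r : L → L → ℕ} (hr : IsRankFunction r) {a b : L}
    (hab : a < b) : ∀ᶠ x in around a ×ˢ around b, boxCount r x.1 x.2 = mult r a b := by
  refine eventually_eq_liminf ?_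
  filter_upwards [(eventually_mem_around a).prod_mk (eventually_mem_around b),
    eventually_around_lt_around hab] with x hx hlt
  exact hr.eventually_boxCount_le hx.1 hx.2 hlt

theorem IsRankFunction.rowCount_antitoneOn {r : L → L → ℕ} (hr : IsRankFunction r) (a : L) :
    AntitoneOn (rowCount r a) (Ioi a) := fun d had d' had' hdd' =>
  jump_le_jump (hr.monotoneOn d') (hr.monotoneOn d) had' had fun _ _ h _ h' => hr.box h h' hdd'

theorem IsRankFunction.rowCount_top {r : L → L → ℕ} (hr : IsRankFunction r) (a : L) :
    rowCount r a ⊤ = 0 := by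
  simp only [rowCount, jump, hr.top, liminf_const]

theorem IsRankFunction.eventually_rowCount_eq_add_mult {r : L → L → ℕ} (hr : IsRankFunction r)
    {a b : L} (hab : a < b) :
    ∀ᶠ q in around b, rowCount r a q.1 = rowCount r a q.2 + mult r a b := by
  have box : ∀ᶠ q in around b, ∀ᶠ p in around a, boxCount r p q = mult r a b :=
    (eventually_swap_iff.1 (hr.eventually_boxCount_eq hab)).curry
  filter_upwards [box, eventually_mem_Icc_around b, (tendsto_fst_around b).eventually_const_lt hab]
    with q hbox hqb haq
  have hq : q.1 ≤ q.2 := hqb.1.trans hqb.2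
  obtain ⟨p, hp, hpa, hpq, h₁, h₂⟩ := (hbox.and ((eventually_mem_Icc_around a).and
    (((tendsto_snd_around a).eventually_lt_const haq).and
    ((eventually_eq_add_jump (hr.monotoneOn q.1) haq).and
    (eventually_eq_add_jump (hr.monotoneOn q.2) (haq.trans_le hq)))))).exists
  have := hr.box (hpa.1.trans hpa.2) hpq hq
  simp only [boxCount, rowCount] at hp ⊢
  omega

theorem IsRankFunction.lt_rowCount {r : L → L → ℕ} (hr : IsRankFunction r) {a d : L} {n : ℕ}
    (had : a < d) (hd : d < rowDeath r a n) : n < rowCount r a d := by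
  obtain ⟨d', hd', hdd'⟩ := lt_sSup_iff.1 hd
  exact hd'.2.trans_le (hr.rowCount_antitoneOn a had hd'.1 hdd'.le)

theorem IsRankFunction.exists_rowDeath_eq_iff {r : L → L → ℕ} (hr : IsRankFunction r) {a b : L}
    (hab : a < b) : ∃ c, ∀ n, rowDeath r a n = b ↔ c ≤ n ∧ n < c + mult r a b := by
  obtain ⟨q, hq, hmem, haq⟩ := ((hr.eventually_rowCount_eq_add_mult hab).and
    ((eventually_mem_around b).and ((tendsto_fst_around b).eventually_const_lt hab))).exists
  have hq₁ : q.1 < b := hmem.1.resolve_left (bot_le.trans_lt haq).ne'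
  refine ⟨rowCount r a q.2, fun n => ⟨?_, fun ⟨hn, hn'⟩ => ?_⟩⟩
  · rintro rfl
    refine ⟨?_, hq ▸ hr.lt_rowCount haq hq₁⟩
    rcases hmem.2 with h | h
    · exact h ▸ (hr.rowCount_top a).trans_le n.zero_le
    · exact rowCount_le (hab.trans h) h
  · have near : ∀ᶠ x in around b, a < x.1 ∧ n < rowCount r a x.1 ∧ rowCount r a x.2 ≤ n := by
      filter_upwards [eventually_nested_around hmem, hr.eventually_rowCount_eq_add_mult hab]
        with x ⟨h₁, _, h₃, h₄⟩ hx
      have hax : a < x.2 := hab.trans_le h₃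
      have anti₁ := hr.rowCount_antitoneOn a haq (haq.trans_le h₁) h₁
      have anti₂ := hr.rowCount_antitoneOn a hax (hax.trans_le h₄) h₄
      exact ⟨haq.trans_le h₁, by omega, by omega⟩
    apply le_antisymm
    · refine sSup_le fun d hd => ge_of_tendsto (tendsto_snd_around b) ?_
      filter_upwards [near, eventually_mem_Icc_around b] with x hx hbx
      by_contra! hxd
      have anti := hr.rowCount_antitoneOn a (hab.trans_le hbx.2) hd.1 hxd.le
      exact (hd.2.trans_le anti).not_ge hx.2.2
    · refine le_of_tendsto (tendsto_fst_around b) ?_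
      filter_upwards [near] with x hx
      exact le_sSup ⟨hx.1, hx.2.1⟩

end RankFunction

section Matching

variable {L : Type*} [CompleteLinearOrder L] [TopologicalSpace L]

/-- The bars `(a, b)` of a rank function, a bar of multiplicity `m` being listed `m` times. -/
abbrev Bar (r : L → L → ℕ) : Type _ :=
  {p : (L × L) × ℕ // p.1.1 < p.1.2 ∧ p.2 < mult r p.1.1 p.1.2}

/-- The birth of a bar. -/
abbrev Bar.birth {r : L → L → ℕ} (p : Bar r) : L := p.1.1.1

/-- The death of a bar. -/
abbrev Bar.death {r : L → L → ℕ} (p : Bar r) : L := p.1.1.2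

/-- The bars of a rank function as pairs `(a, n)`, where `a` is the birth and `n` is the position
among the bars with the same birth, in the order of decreasing deaths. -/
abbrev RowBar (r : L → L → ℕ) : Type _ := {x : L × ℕ // x.1 < rowDeath r x.1 x.2}

/-- The increments of `r · d` are bounded by those of `r' · d`: in each row, `r'` has at least as
many bars dying after `d` as `r`. -/
def RowLE (r r' : L → L → ℕ) : Prop :=
  ∀ ⦃a₁ a₂ d⦄, a₁ ≤ a₂ → a₂ < d → r a₂ d + r' a₁ d ≤ r' a₂ d + r a₁ d

theorem map_swap_around (a : L) :
    map (fun p => (OrderDual.toDual p.2, OrderDual.toDual p.1)) (around a) =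
      around (OrderDual.toDual a) :=
  Filter.prod_comm.symm

theorem mult_dualRank (r : L → L → ℕ) (a b : L) :
    mult (dualRank r) (OrderDual.toDual b) (OrderDual.toDual a) = mult r a b := by
  rw [mult, ← map_swap_around, ← map_swap_around, prod_map_map_eq, Filter.prod_comm, map_map,
    ← liminf_comp, mult]
  congr 1
  ext x
  simp only [Function.comp_apply, boxCount, dualRank, Prod.fst_swap, Prod.snd_swap,
    OrderDual.ofDual_toDual]
  omega

/-- Exchanging birth and death. -/
def dualBar (r : L → L → ℕ) : Bar r ≃ Bar (dualRank r) where
  toFun p := ⟨((OrderDual.toDual p.death, OrderDual.toDual p.birth), p.1.2), p.2.1,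
    p.2.2.trans_eq (mult_dualRank r _ _).symm⟩
  invFun p := ⟨((OrderDual.ofDual p.death, OrderDual.ofDual p.birth), p.1.2), p.2.1,
    p.2.2.trans_eq (mult_dualRank r _ _)⟩
  left_inv _ := rfl
  right_inv _ := rfl

variable [OrderTopology L]

theorem map_around (e : L ≃o L) (a : L) : map (Prod.map e e) (around a) = around (e a) := by
  have := e.toHomeomorph.isEmbedding.map_nhdsWithin_eq
  simp only [OrderIso.coe_toHomeomorph] at this
  rw [around, ← prod_map_map_eq', this, this, image_insert_eq, image_insert_eq, e.image_Iio,
    e.image_Ioi, e.map_bot, e.map_top, around]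

theorem mult_comp_orderIso (r : L → L → ℕ) (e : L ≃o L) (a b : L) :
    mult (fun a b => r (e a) (e b)) a b = mult r (e a) (e b) := by
  rw [mult, mult, ← map_around, ← map_around, prod_map_map_eq, ← liminf_comp]
  rfl

/-- Reparametrization of births and deaths along an order isomorphism. -/
def compBar (r : L → L → ℕ) (e : L ≃o L) : Bar (fun a b => r (e a) (e b)) ≃ Bar r where
  toFun p := ⟨((e p.birth, e p.death), p.1.2), e.strictMono p.2.1,
    p.2.2.trans_eq (mult_comp_orderIso r e _ _)⟩
  invFun p := ⟨((e.symm p.birth, e.symm p.death), p.1.2), e.symm.strictMono p.2.1, by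
    simpa only [mult_comp_orderIso, e.apply_symm_apply] using p.2.2⟩
  left_inv p := by simp [Bar.birth, Bar.death]
  right_inv p := by simp [Bar.birth, Bar.death]

variable [DenselyOrdered L]

theorem IsRankFunction.exists_rowBar_equiv_bar {r : L → L → ℕ} (hr : IsRankFunction r) :
    ∃ e : RowBar r ≃ Bar r,
      ∀ x, (e x).birth = x.1.1 ∧ (e x).death = rowDeath r x.1.1 x.1.2 := by
  choose! c hc using fun a b (hab : a < b) => hr.exists_rowDeath_eq_iff hab
  have index (x : RowBar r) := (hc _ _ x.2 x.1.2).1 rfl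
  let toBar (x : RowBar r) : Bar r :=
    ⟨((x.1.1, rowDeath r x.1.1 x.1.2), x.1.2 - c x.1.1 (rowDeath r x.1.1 x.1.2)), x.2,
      Nat.sub_lt_left_of_lt_add (index x).1 (index x).2⟩
  refine ⟨Equiv.ofBijective toBar ⟨?_, ?_⟩, fun _ => ⟨rfl, rfl⟩⟩
  · rintro ⟨⟨a, n⟩, hn⟩ ⟨⟨a', n'⟩, hn'⟩ h
    obtain ⟨⟨rfl, death_eq⟩, index_eq⟩ :=
      (Prod.ext_iff.1 (Subtype.ext_iff.1 h)).imp_left Prod.ext_iff.1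
    have hle := (index ⟨_, hn⟩).1
    have hle' := (index ⟨_, hn'⟩).1
    dsimp only [toBar] at hle hle' death_eq index_eq
    rw [death_eq] at hle index_eq
    obtain rfl : n = n' := by omega
    rfl
  · rintro ⟨⟨⟨a, b⟩, i⟩, hab, hi⟩
    have death : rowDeath r a (c a b + i) = b :=
      (hc a b hab _).2 ⟨Nat.le_add_right _ _, Nat.add_lt_add_left hi _⟩
    refine ⟨⟨(a, c a b + i), hab.trans_eq death.symm⟩, ?_⟩
    simp only [toBar, death, Nat.add_sub_cancel_left]

theorem RowLE.rowCount_le {r r' : L → L → ℕ} (h : RowLE r r') (hr : IsRankFunction r)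
    (hr' : IsRankFunction r') {a d : L} (had : a < d) : rowCount r a d ≤ rowCount r' a d :=
  jump_le_jump (hr.monotoneOn d) (hr'.monotoneOn d) had had fun _ _ h₁ h₂ _ => h h₁ h₂

theorem RowLE.rowDeath_le {r r' : L → L → ℕ} (h : RowLE r r') (hr : IsRankFunction r)
    (hr' : IsRankFunction r') (a : L) (n : ℕ) : rowDeath r a n ≤ rowDeath r' a n :=
  sSup_le_sSup fun _ hd => ⟨hd.1, hd.2.trans_le (h.rowCount_le hr hr' hd.1)⟩

theorem rowDeath_le_of_shift {r r' : L → L → ℕ} (hr : IsRankFunction r) (hr' : IsRankFunction r')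
    (s : L ≃o L) (hs : ∀ x, x ≤ s x) (h : RowLE (fun a d => r a (s d)) r') (a : L) (n : ℕ) :
    rowDeath r a n ≤ s (max a (rowDeath r' a n)) := by
  refine le_of_forall_gt_imp_ge_of_dense fun d hd => ?_
  obtain ⟨d, rfl⟩ := s.surjective d
  obtain ⟨had, hd⟩ := max_lt_iff.1 (s.lt_iff_lt.1 hd)
  by_contra! hlt
  have := hr.lt_rowCount (had.trans_le (hs d)) hlt
  exact ((rowCount_le had hd).trans_lt this).not_ge (h.rowCount_le (hr.shift s hs) hr' had)

theorem exists_rowMatching {r r' : L → L → ℕ} (hr : IsRankFunction r) (hr' : IsRankFunction r')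
    (s : L ≃o L) (hs : ∀ x, x ≤ s x) (h₁ : RowLE r' r) (h₂ : RowLE (fun a d => r a (s d)) r') :
    ∃ ι : Bar r' → Bar r, Function.Injective ι ∧
      (∀ p, (ι p).birth = p.birth ∧ p.death ≤ (ι p).death ∧ (ι p).death ≤ s p.death) ∧
      ∀ q : Bar r, s q.birth < q.death → q ∈ range ι := by
  obtain ⟨e, he⟩ := hr.exists_rowBar_equiv_bar
  obtain ⟨e', he'⟩ := hr'.exists_rowBar_equiv_bar
  have below := h₁.rowDeath_le hr' hr
  have above := rowDeath_le_of_shift hr hr' s hs h₂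
  let incl : RowBar r' ↪ RowBar r := Subtype.impEmbedding _ _ fun x hx => hx.trans_le (below _ _)
  refine ⟨e ∘ incl ∘ e'.symm, e.injective.comp (incl.injective.comp e'.symm.injective),
    fun p => ?_, fun q hq => ?_⟩
  · obtain ⟨x, rfl⟩ := e'.surjective p
    simp only [Function.comp_apply, e'.symm_apply_apply, (he _).1, (he _).2, (he' x).1, (he' x).2]
    exact ⟨rfl, below _ _, (above _ _).trans_eq (congrArg s (max_eq_right x.2.le))⟩
  · obtain ⟨x, rfl⟩ := e.surjective q
    rw [(he x).1, (he x).2] at hq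
    have hx : x.1.1 < rowDeath r' x.1.1 x.1.2 :=
      (lt_max_iff.1 (s.lt_iff_lt.1 (hq.trans_le (above _ _)))).resolve_left (lt_irrefl _)
    exact ⟨e' ⟨x.1, hx⟩, by simp only [Function.comp_apply, e'.symm_apply_apply]; rfl⟩

theorem exists_columnMatching {r r' : L → L → ℕ} (hr : IsRankFunction r)
    (hr' : IsRankFunction r') (s : L ≃o L) (hs : ∀ x, x ≤ s x)
    (h₁ : RowLE (dualRank r') (dualRank r))
    (h₂ : RowLE (dualRank fun a d => r (s.symm a) d) (dualRank r')) :
    ∃ ι : Bar r' → Bar r, Function.Injective ι ∧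
      (∀ p, (ι p).death = p.death ∧ (ι p).birth ≤ p.birth ∧ p.birth ≤ s (ι p).birth) ∧
      ∀ q : Bar r, s q.birth < q.death → q ∈ range ι := by
  obtain ⟨ι, inj, close, surj⟩ := exists_rowMatching hr.dual hr'.dual s.symm.dual
    (fun x => s.symm_apply_le.2 (hs _)) h₁ h₂
  refine ⟨(dualBar r).symm ∘ ι ∘ dualBar r',
    (dualBar r).symm.injective.comp (inj.comp (dualBar r').injective), fun p => ?_, fun q hq => ?_⟩
  · obtain ⟨death, below, above⟩ := close (dualBar r' p)
    exact ⟨congrArg OrderDual.ofDual death, below, s.symm_apply_le.1 above⟩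
  · obtain ⟨p, hp⟩ := surj (dualBar r q) (s.lt_symm_apply.2 hq)
    exact ⟨(dualBar r').symm p, by simp [hp]⟩

/-- The rank function `r'` interpolates between `r₁` and `r₂` along `e`: its bars arise from those
of `r₁` by moving deaths down, by at most `e ∘ e`, and from those of `r₂`, reparametrized by `e`, by
moving births up, by at most `e ∘ e`. -/
structure IsInterpolant (r₁ r₂ r' : L → L → ℕ) (e : L ≃o L) : Prop where
  row : RowLE r' r₁
  row_shift : RowLE (fun a d => r₁ a (e (e d))) r'
  column : RowLE (dualRank r') (dualRank fun a b => r₂ (e a) (e b))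
  column_shift : RowLE (dualRank fun a b => r₂ (e.symm a) (e b)) (dualRank r')

theorem exists_matching {r₁ r₂ r' : L → L → ℕ} {e : L ≃o L} (h : IsInterpolant r₁ r₂ r' e)
    (hr₁ : IsRankFunction r₁) (hr₂ : IsRankFunction r₂) (hr' : IsRankFunction r')
    (he : ∀ x, x ≤ e x) :
    ∃ (ι₁ : Bar r' → Bar r₁) (ι₂ : Bar r' → Bar r₂), Function.Injective ι₁ ∧
      Function.Injective ι₂ ∧
      (∀ p, (ι₁ p).birth ≤ e (ι₂ p).birth ∧ (ι₂ p).birth ≤ e (ι₁ p).birth ∧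
        (ι₁ p).death ≤ e (ι₂ p).death ∧ (ι₂ p).death ≤ e (ι₁ p).death) ∧
      (∀ q : Bar r₁, e (e q.birth) < q.death → q ∈ range ι₁) ∧
      (∀ q : Bar r₂, e (e q.birth) < q.death → q ∈ range ι₂) := by
  have he₂ (x : L) : x ≤ (e.trans e) x := (he x).trans (he _)
  obtain ⟨ι₁, inj₁, close₁, surj₁⟩ :=
    exists_rowMatching hr₁ hr' (e.trans e) he₂ h.row h.row_shift
  obtain ⟨ι₂, inj₂, close₂, surj₂⟩ := exists_columnMatching (hr₂.comp_orderIso e) hr' (e.trans e)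
    he₂ h.column (by simpa using h.column_shift)
  refine ⟨ι₁, compBar r₂ e ∘ ι₂, inj₁, (compBar r₂ e).injective.comp inj₂, fun p => ?_,
    surj₁, fun q hq => ?_⟩
  · obtain ⟨birth₁, below₁, above₁⟩ := close₁ p
    obtain ⟨death₂, below₂, above₂⟩ := close₂ p
    exact ⟨birth₁.trans_le above₂, e.monotone (below₂.trans_eq birth₁.symm),
      above₁.trans_eq (congrArg (e.trans e) death₂.symm),
      e.monotone (death₂.trans_le below₁)⟩
  · obtain ⟨p, hp⟩ := surj₂ ((compBar r₂ e).symm q) (by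
      simpa [compBar, Bar.birth, Bar.death, e.lt_symm_apply] using hq)
    exact ⟨p, by simp [hp]⟩

end Matching

section Countable

variable {L : Type*} [CompleteLinearOrder L] [TopologicalSpace L] [OrderTopology L]
  [DenselyOrdered L]

theorem jump_eq_zero {g : L → ℕ} {a : L} (hg : ContinuousAt g a) : jump g a = 0 := by
  have near : ∀ᶠ x in 𝓝 a, g x = g a := hg.eventually_mem (isOpen_discrete {g a} |>.mem_nhds rfl)
  have stable : ∀ᶠ p in around a, g p.2 - g p.1 = 0 := by
    filter_upwards [(tendsto_fst_around a).eventually near, (tendsto_snd_around a).eventually near]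
      with p h₁ h₂
    rw [h₁, h₂, Nat.sub_self]
  rw [jump, liminf_congr stable, liminf_const]

theorem IsRankFunction.countable_rowCount_ne_zero [SecondCountableTopology L] {r : L → L → ℕ}
    (hr : IsRankFunction r) (d : L) : {a | a < d ∧ rowCount r a d ≠ 0}.Countable := by
  refine (hr.monotoneOn d).countable_not_continuousWithinAt.mono ?_
  rintro a ⟨had, ha⟩
  exact ⟨had, fun h => ha (jump_eq_zero (h.continuousAt (Iio_mem_nhds had)))⟩

theorem IsRankFunction.countable_births [SecondCountableTopology L] {r : L → L → ℕ}
    (hr : IsRankFunction r) : {a | ∃ n, a < rowDeath r a n}.Countable := by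
  obtain ⟨Q, hQ, hQd⟩ := TopologicalSpace.exists_countable_dense L
  refine (hQ.biUnion fun d _ => hr.countable_rowCount_ne_zero d).mono ?_
  rintro a ⟨n, hn⟩
  obtain ⟨d, hdQ, had, hdn⟩ := hQd.exists_between hn
  exact mem_biUnion hdQ ⟨had, (hr.lt_rowCount had hdn).ne_bot⟩

theorem IsRankFunction.countable_bar [SecondCountableTopology L] {r : L → L → ℕ}
    (hr : IsRankFunction r) : Countable (Bar r) := by
  obtain ⟨e, -⟩ := hr.exists_rowBar_equiv_bar
  have := hr.countable_births.to_subtype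
  have inj : Function.Injective fun x : RowBar r =>
      ((⟨x.1.1, x.1.2, x.2⟩ : {a | ∃ n, a < rowDeath r a n}), x.1.2) := fun x y h => by
    simp only [Prod.mk.injEq, Subtype.mk.injEq] at h
    exact Subtype.ext (Prod.ext h.1 h.2)
  exact e.countable_iff.1 inj.countable

end Countable

section PersistenceModule

variable {F V₁ V₂ V₃ V₄ : Type*} [Field F] [AddCommGroup V₁] [Module F V₁] [AddCommGroup V₂]
  [Module F V₂] [AddCommGroup V₃] [Module F V₃] [AddCommGroup V₄] [Module F V₄]

theorem finrank_map_add_finrank_inf_ker (S : Submodule F V₁) [Module.Finite F S]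
    (w : V₁ →ₗ[F] V₂) :
    Module.finrank F (S.map w) + Module.finrank F ↥(S ⊓ LinearMap.ker w) =
      Module.finrank F S := by
  rw [← LinearMap.finrank_range_add_finrank_ker (w.domRestrict S), LinearMap.range_domRestrict,
    LinearMap.ker_domRestrict, ← Submodule.map_comap_subtype,
    Submodule.finrank_map_subtype_eq]

theorem finrank_range_comp_add_le (x : V₁ →ₗ[F] V₂) (y : V₂ →ₗ[F] V₃) (z : V₃ →ₗ[F] V₄)
    [Module.Finite F (LinearMap.range y)] :
    Module.finrank F (LinearMap.range (z ∘ₗ y)) + Module.finrank F (LinearMap.range (y ∘ₗ x)) ≤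
      Module.finrank F (LinearMap.range y) +
        Module.finrank F (LinearMap.range (z ∘ₗ y ∘ₗ x)) := by
  have hle : LinearMap.range (y ∘ₗ x) ≤ LinearMap.range y := LinearMap.range_comp_le_range x y
  have := Submodule.finiteDimensional_of_le hle
  have rank_y := finrank_map_add_finrank_inf_ker (LinearMap.range y) z
  have rank_yx := finrank_map_add_finrank_inf_ker (LinearMap.range (y ∘ₗ x)) z
  rw [← LinearMap.range_comp] at rank_y rank_yx
  have := Submodule.finiteDimensional_of_le
    (inf_le_left : LinearMap.range y ⊓ LinearMap.ker z ≤ LinearMap.range y)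
  have := Submodule.finrank_mono (inf_le_inf_right (LinearMap.ker z) hle)
  omega

variable {P : Type*} [Preorder P] (M : P ⥤ ModuleCat F)

/-- The structure map of a persistence module has finite rank (vacuous unless `a ≤ b`). -/
def FiniteRank (a b : P) : Prop :=
  ∀ h : a ≤ b, Module.Finite F (LinearMap.range (M.map (homOfLE h)).hom)

open scoped Classical in
/-- The rank of the structure map of a persistence module, with value `0` unless `a ≤ b`. -/
noncomputable def rank (a b : P) : ℕ :=
  if h : a ≤ b then Module.finrank F (LinearMap.range (M.map (homOfLE h)).hom) else 0

variable {M}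

theorem map_homOfLE_hom_comp {a b c : P} (h : a ≤ b) (h' : b ≤ c) :
    (M.map (homOfLE h')).hom ∘ₗ (M.map (homOfLE h)).hom = (M.map (homOfLE (h.trans h'))).hom := by
  rw [← ModuleCat.hom_comp, ← M.map_comp, homOfLE_comp]

theorem FiniteRank.mono {a a' b b' : P} (h : FiniteRank M a b) (ha : a' ≤ a) (hab : a ≤ b)
    (hb : b ≤ b') : FiniteRank M a' b' := fun _ => by
  have := h hab
  have hle := LinearMap.range_comp_le_range (M.map (homOfLE ha)).hom
    ((M.map (homOfLE hb)).hom ∘ₗ (M.map (homOfLE hab)).hom)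
  rw [LinearMap.range_comp (M.map (homOfLE hab)).hom, map_homOfLE_hom_comp,
    map_homOfLE_hom_comp] at hle
  exact Submodule.finiteDimensional_of_le hle

theorem FiniteRank.of_subsingleton_left {a : P} (ha : Subsingleton (M.obj a)) (b : P) :
    FiniteRank M a b := fun _ => by
  rw [LinearMap.range_eq_bot.2 (Subsingleton.elim _ 0)]
  infer_instance

theorem FiniteRank.of_subsingleton_right (a : P) {b : P} (hb : Subsingleton (M.obj b)) :
    FiniteRank M a b := fun _ => inferInstance

theorem rank_box {a₁ a₂ b₁ b₂ : P} (h₁ : a₁ ≤ a₂) (h₂ : a₂ ≤ b₁) (h₃ : b₁ ≤ b₂)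
    (h : FiniteRank M a₂ b₁) :
    rank M a₂ b₂ + rank M a₁ b₁ ≤ rank M a₂ b₁ + rank M a₁ b₂ := by
  have := h h₂
  have := finrank_range_comp_add_le (M.map (homOfLE h₁)).hom (M.map (homOfLE h₂)).hom
    (M.map (homOfLE h₃)).hom
  rw [map_homOfLE_hom_comp, map_homOfLE_hom_comp, map_homOfLE_hom_comp] at this
  simpa only [rank, h₁.trans h₂, h₂.trans h₃, h₂, h₁.trans (h₂.trans h₃), dif_pos] using this

theorem rank_eq_zero_of_subsingleton_left {a : P} (ha : Subsingleton (M.obj a)) (b : P) :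
    rank M a b = 0 := by
  unfold rank
  split_ifs with h
  · rw [LinearMap.range_eq_bot.2 (Subsingleton.elim _ 0), finrank_bot]
  · rfl

theorem rank_eq_zero_of_subsingleton_right (a : P) {b : P} (hb : Subsingleton (M.obj b)) :
    rank M a b = 0 := by
  unfold rank
  split_ifs with h
  · exact Module.finrank_zero_of_subsingleton
  · rfl

section Chain

variable {L : Type*} [CompleteLinearOrder L]

/-- The rank function of the maps from the persistence module at `A a` to the one at `B b`. -/
noncomputable def chainRank (M : P ⥤ ModuleCat F) (A B : L → P) (a b : L) : ℕ :=
  rank M (A a) (B b)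

/-- A chain of indices along which a persistence module is tame and vanishes at both ends. -/
structure IsTameChain (M : P ⥤ ModuleCat F) (A : L → P) : Prop where
  monotone : Monotone A
  bot : Subsingleton (M.obj (A ⊥))
  top : Subsingleton (M.obj (A ⊤))
  finiteRank : ∀ {a b}, a < b → FiniteRank M (A a) (A b)

variable {A B : L → P}

theorem IsTameChain.isRankFunction (hA : IsTameChain M A) : IsRankFunction (chainRank M A A) where
  bot _ := rank_eq_zero_of_subsingleton_left hA.bot _
  top _ := rank_eq_zero_of_subsingleton_right _ hA.top
  box h₁ h₂ h₃ := rank_box (hA.monotone h₁) (hA.monotone h₂.le) (hA.monotone h₃) (hA.finiteRank h₂)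

variable {e : L ≃o L}

theorem IsTameChain.finiteRank_shift (hA : IsTameChain M A) (hAB : ∀ a, A a ≤ B (e a)) {a b : L}
    (hab : a < b) : FiniteRank M (A a) (B (e b)) :=
  (hA.finiteRank hab).mono le_rfl (hA.monotone hab.le) (hAB b)

theorem IsTameChain.isRankFunction_shift (hA : IsTameChain M A) (hB : IsTameChain M B)
    (hAB : ∀ a, A a ≤ B (e a)) : IsRankFunction (chainRank M A (B ∘ e)) where
  bot _ := rank_eq_zero_of_subsingleton_left hA.bot _
  top _ := rank_eq_zero_of_subsingleton_right _ (by simpa using hB.top)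
  box h₁ h₂ h₃ := rank_box (hA.monotone h₁) ((hA.monotone h₂.le).trans (hAB _))
    (hB.monotone (e.monotone h₃)) (hA.finiteRank_shift hAB h₂)

theorem IsTameChain.isInterpolant (hA : IsTameChain M A) (hB : IsTameChain M B)
    (hAB : ∀ a, A a ≤ B (e a)) (hBA : ∀ a, B a ≤ A (e a)) :
    IsInterpolant (chainRank M A A) (chainRank M B B) (chainRank M A (B ∘ e)) e where
  row _ _ d h h' := rank_box (hA.monotone h) (hA.monotone h'.le) (hAB d) (hA.finiteRank h')
  row_shift _ _ d h h' := rank_box (hA.monotone h) ((hA.monotone h'.le).trans (hAB d)) (hBA _)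
    (hA.finiteRank_shift hAB h')
  column _ _ a h h' := by
    have := rank_box (hAB a) (hB.monotone (e.monotone h'.le)) (hB.monotone (e.monotone h))
      (hB.finiteRank (e.strictMono h'))
    exact (add_comm _ _).trans_le this
  column_shift b₁ b₂ a h h' := by
    have h : OrderDual.ofDual b₂ ≤ OrderDual.ofDual b₁ := h
    have h' : OrderDual.ofDual a < OrderDual.ofDual b₂ := h'
    have := rank_box (by simpa using hBA (e.symm (OrderDual.ofDual a)))
      ((hA.monotone h'.le).trans (hAB _)) (hB.monotone (e.monotone h)) (hA.finiteRank_shift hAB h')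
    exact (add_comm _ _).trans_le this

end Chain

end PersistenceModule

section Homology

variable (F : Type v) [Field F] (k : ℤ)

variable {k} in
theorem subsingleton_homology_of_ne_zero (Y : TopCat.{u}) [TotallyDisconnectedSpace Y]
    (hk : k ≠ 0) : Subsingleton ((homologyFunctor.{u, v} F k).obj Y) :=
  match k with
  | Int.ofNat n => ModuleCat.subsingleton_of_isZero
      (AlgebraicTopology.isZero_singularHomologyFunctor_of_totallyDisconnectedSpace
        (ModuleCat.{max u v} F) n (ModuleCat.of F (ULift.{max u v} F)) Y
        fun hn => hk (by simp [hn]))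
  | Int.negSucc _ => inferInstanceAs (Subsingleton PUnit.{max u v + 1})

/-- The zeroth homology of a totally disconnected space has its points as a basis. -/
noncomputable def homologyZeroEquiv (Y : TopCat.{u}) [TotallyDisconnectedSpace Y] [DecidableEq Y] :
    (homologyFunctor.{u, v} F 0).obj Y ≃ₗ[F] DirectSum Y fun _ => ULift.{max u v} F :=
  (AlgebraicTopology.singularHomologyFunctorZeroOfTotallyDisconnectedSpace
    (ModuleCat.{max u v} F) (ModuleCat.of F (ULift.{max u v} F)) Y ≪≫
      ModuleCat.coprodIsoDirectSum _).toLinearEquiv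

theorem finite_homology (Y : TopCat.{u}) [TotallyDisconnectedSpace Y] [Finite Y] :
    Module.Finite F ((homologyFunctor.{u, v} F k).obj Y) := by
  classical
  have := Fintype.ofFinite Y
  rcases eq_or_ne k 0 with rfl | hk
  · exact (Module.Finite.equiv_iff (homologyZeroEquiv F Y)).2 inferInstance
  · have := subsingleton_homology_of_ne_zero F Y hk
    infer_instance

theorem subsingleton_homology (Y : TopCat.{u}) [IsEmpty Y] :
    Subsingleton ((homologyFunctor.{u, v} F k).obj Y) := by
  classical
  rcases eq_or_ne k 0 with rfl | hk
  · exact (homologyZeroEquiv F Y).subsingleton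
  · exact subsingleton_homology_of_ne_zero F Y hk

/-- The subspaces of a topological space and their inclusions. -/
def subspaces (X : Type u) [TopologicalSpace X] : Set X ⥤ TopCat.{u} where
  obj A := TopCat.of A
  map h := TopCat.ofHom ⟨Set.inclusion (leOfHom h), continuous_inclusion (leOfHom h)⟩

end Homology

section Sublevel

/-- The extension of a persistence module by the zero space at infinity. -/
def extendByZero {F : Type v} [Field F] {P : Type*} [Preorder P] (M : P ⥤ ModuleCat.{u} F) :
    WithTop P ⥤ ModuleCat.{u} F where
  obj
    | ⊤ => ModuleCat.of F PUnit
    | (a : P) => M.obj a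
  map {a b} h := match a, b, leOfHom h with
    | _, ⊤, _ => 0
    | (a : P), (b : P), h => M.map (homOfLE (WithTop.coe_le_coe.1 h))
    | ⊤, (b : P), h => absurd h (WithTop.not_top_le_coe b)
  map_id
    | ⊤ => rfl
    | (a : P) => M.map_id a
  map_comp {a b c} h h' := match a, b, c, leOfHom h, leOfHom h' with
    | (a : P), (b : P), (c : P), _, _ => M.map_comp _ _
    | _, _, ⊤, _, _ => rfl
    | _, ⊤, (c : P), _, h' => absurd h' (WithTop.not_top_le_coe c)
    | ⊤, (b : P), (c : P), h, _ => absurd h (WithTop.not_top_le_coe b)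

variable {X : Type u} [TopologicalSpace X]

/-- The chain of sublevel sets `{x | f x ≤ a}`, `a < ∞`, with an index at infinity added. -/
noncomputable def sublevelChain (f : C(X, ℝ)) (a : EReal) : WithTop (Set X) :=
  if a = ⊤ then ⊤ else ({x | (f x : EReal) ≤ a} : Set X)

theorem sublevelChain_top (f : C(X, ℝ)) : sublevelChain f ⊤ = ⊤ := if_pos rfl

theorem sublevelChain_of_ne_top (f : C(X, ℝ)) {a : EReal} (ha : a ≠ ⊤) :
    sublevelChain f a = ({x | (f x : EReal) ≤ a} : Set X) := if_neg ha

theorem sublevelChain_coe (f : C(X, ℝ)) (a : ℝ) : sublevelChain f a = ({x | f x ≤ a} : Set X) := by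
  simp only [sublevelChain_of_ne_top f (EReal.coe_ne_top a), EReal.coe_le_coe_iff]

theorem sublevelChain_bot (f : C(X, ℝ)) : sublevelChain f ⊥ = (∅ : Set X) := by
  simp [sublevelChain_of_ne_top]

theorem sublevelChain_le_sublevelChain {f g : C(X, ℝ)} {a b : EReal} (hab : a = ⊤ → b = ⊤)
    (h : ∀ x, (f x : EReal) ≤ a → (g x : EReal) ≤ b) : sublevelChain f a ≤ sublevelChain g b := by
  rcases eq_or_ne b ⊤ with rfl | hb
  · exact le_top.trans_eq (sublevelChain_top g).symm
  · rw [sublevelChain_of_ne_top f (mt hab hb), sublevelChain_of_ne_top g hb, WithTop.coe_le_coe]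
    exact h

theorem sublevelChain_monotone (f : C(X, ℝ)) : Monotone (sublevelChain f) := fun _ _ hab =>
  sublevelChain_le_sublevelChain (fun h => top_le_iff.1 (h ▸ hab)) fun _ hx => hx.trans hab

theorem sublevelChain_le_sublevelChain_orderIso {f g : C(X, ℝ)} {e : EReal ≃o EReal}
    (h : ∀ x, (g x : EReal) ≤ e (f x)) (a : EReal) : sublevelChain f a ≤ sublevelChain g (e a) :=
  sublevelChain_le_sublevelChain (fun h => h ▸ e.map_top) fun x hx => (h x).trans (e.monotone hx)

variable (F : Type v) [Field F] (k : ℤ)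

/-- The homology of the subspaces of `X`, extended by zero at infinity. -/
noncomputable def subspaceHomology (X : Type u) [TopologicalSpace X] :
    WithTop (Set X) ⥤ ModuleCat.{max u v} F :=
  extendByZero (subspaces X ⋙ homologyFunctor.{u, v} F k)

variable {F k} {f : C(X, ℝ)}

theorem rank_subspaceHomology_sublevelChain {a b : ℝ} (hab : a ≤ b) :
    rank (subspaceHomology F k X) (sublevelChain f a) (sublevelChain f b) = betti F k f a b := by
  rw [sublevelChain_coe, sublevelChain_coe, betti, dif_pos hab, rank,
    dif_pos (WithTop.coe_le_coe.2 fun x (hx : f x ≤ a) => hx.trans hab)]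
  rfl

theorem subsingleton_subspaceHomology_sublevelChain_bot (f : C(X, ℝ)) :
    Subsingleton ((subspaceHomology F k X).obj (sublevelChain f ⊥)) := by
  rw [sublevelChain_bot]
  exact subsingleton_homology F k (TopCat.of (∅ : Set X))

theorem subsingleton_subspaceHomology_sublevelChain_top (f : C(X, ℝ)) :
    Subsingleton ((subspaceHomology F k X).obj (sublevelChain f ⊤)) := by
  rw [sublevelChain_top]
  exact inferInstanceAs (Subsingleton PUnit)

theorem IsTame.isTameChain (hf : IsTame F k f) :
    IsTameChain (subspaceHomology F k X) (sublevelChain f) where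
  monotone := sublevelChain_monotone f
  bot := subsingleton_subspaceHomology_sublevelChain_bot f
  top := subsingleton_subspaceHomology_sublevelChain_top f
  finiteRank {a b} hab := by
    rcases eq_or_ne a ⊥ with rfl | ha
    · exact .of_subsingleton_left (subsingleton_subspaceHomology_sublevelChain_bot f) _
    rcases eq_or_ne b ⊤ with rfl | hb
    · exact .of_subsingleton_right _ (subsingleton_subspaceHomology_sublevelChain_top f)
    lift a to ℝ using ⟨hab.ne_top, ha⟩
    lift b to ℝ using ⟨hb, hab.ne_bot⟩
    rw [sublevelChain_coe, sublevelChain_coe]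
    exact fun _ => hf a b (EReal.coe_lt_coe_iff.1 hab)

end Sublevel

section Multiplicity

theorem IsRankFunction.mult_eq_sInf {L : Type*} [CompleteLinearOrder L] [TopologicalSpace L]
    [OrderTopology L] [DenselyOrdered L] {r : L → L → ℕ} (hr : IsRankFunction r) {a b : L}
    (hab : a < b) {ι : Type*} {l : Filter ι} [l.NeBot] {p q : ι → L × L} {S : Set ι} (hS : S ∈ l)
    (hp : Tendsto p l (around a)) (hq : Tendsto q l (around b))
    (hmem : ∀ i ∈ S, ((p i).1 ∈ insert ⊥ (Iio a) ∧ (p i).2 ∈ insert ⊤ (Ioi a)) ∧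
      ((q i).1 ∈ insert ⊥ (Iio b) ∧ (q i).2 ∈ insert ⊤ (Ioi b)) ∧ (p i).2 < (q i).1) :
    mult r a b = sInf ((fun i => boxCount r (p i) (q i)) '' S) := by
  have hpq := hp.prodMk hq
  have min : ∀ᶠ i in l, boxCount r (p i) (q i) = sInf ((fun i => boxCount r (p i) (q i)) '' S) :=
    eventually_eq_sInf_image hS fun i hi =>
      hpq.eventually (hr.eventually_boxCount_le (hmem i hi).1 (hmem i hi).2.1 (hmem i hi).2.2)
  obtain ⟨i, hi, hi'⟩ := ((hpq.eventually (hr.eventually_boxCount_eq hab)).and min).exists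
  exact hi.symm.trans hi'

theorem tendsto_coe_around (a : ℝ) :
    Tendsto (fun ε : ℝ => (((a - ε : ℝ) : EReal), ((a + ε : ℝ) : EReal))) (𝓝[>] 0)
      (around (a : EReal)) := by
  have lower : Tendsto (fun ε : ℝ => ((a - ε : ℝ) : EReal)) (𝓝[>] 0) (𝓝 a) :=
    ((continuous_coe_real_ereal.comp (continuous_const.sub continuous_id)).tendsto'
      (0 : ℝ) (a : EReal) (by simp)).mono_left nhdsWithin_le_nhds
  have upper : Tendsto (fun ε : ℝ => ((a + ε : ℝ) : EReal)) (𝓝[>] 0) (𝓝 a) :=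
    ((continuous_coe_real_ereal.comp (continuous_const.add continuous_id)).tendsto'
      (0 : ℝ) (a : EReal) (by simp)).mono_left nhdsWithin_le_nhds
  refine (tendsto_nhdsWithin_iff.2 ⟨lower, ?_⟩).prodMk (tendsto_nhdsWithin_iff.2 ⟨upper, ?_⟩)
  all_goals filter_upwards [self_mem_nhdsWithin] with ε (hε : 0 < ε)
  · exact .inr (EReal.coe_lt_coe_iff.2 (sub_lt_self a hε))
  · exact .inr (EReal.coe_lt_coe_iff.2 (lt_add_of_pos_right a hε))

theorem tendsto_coe_around_top :
    Tendsto (fun c : ℝ => ((c : EReal), (⊤ : EReal))) atTop (around ⊤) :=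
  (tendsto_nhdsWithin_iff.2 ⟨EReal.tendsto_coe_nhds_top_iff.2 tendsto_id,
    .of_forall fun c => .inr (EReal.coe_lt_top c)⟩).prodMk
    (tendsto_nhdsWithin_iff.2 ⟨tendsto_const_nhds, .of_forall fun _ => mem_insert _ _⟩)

variable {X : Type u} [TopologicalSpace X] {F : Type v} [Field F] {k : ℤ} {f : C(X, ℝ)}

variable (F k f) in
/-- The persistent Betti numbers of `f`, extended to infinite levels. -/
noncomputable def sublevelRank : EReal → EReal → ℕ :=
  chainRank (subspaceHomology F k X) (sublevelChain f) (sublevelChain f)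

theorem sublevelRank_coe {a b : ℝ} (hab : a ≤ b) : sublevelRank F k f a b = betti F k f a b :=
  rank_subspaceHomology_sublevelChain hab

theorem IsTame.isRankFunction (hf : IsTame F k f) : IsRankFunction (sublevelRank F k f) :=
  hf.isTameChain.isRankFunction

theorem IsTame.boxCount_coe (hf : IsTame F k f) {a₁ a₂ b₁ b₂ : ℝ} (h₁ : a₁ ≤ a₂) (h₂ : a₂ < b₁)
    (h₃ : b₁ ≤ b₂) :
    (boxCount (sublevelRank F k f) (a₁, a₂) (b₁, b₂) : ℤ) =
      (betti F k f a₂ b₁ : ℤ) - betti F k f a₁ b₁ - betti F k f a₂ b₂ + betti F k f a₁ b₂ := by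
  have := hf.isRankFunction.box (EReal.coe_le_coe_iff.2 h₁) (EReal.coe_lt_coe_iff.2 h₂)
    (EReal.coe_le_coe_iff.2 h₃)
  unfold boxCount
  rw [sublevelRank_coe h₂.le, sublevelRank_coe (h₁.trans h₂.le),
    sublevelRank_coe (h₂.le.trans h₃), sublevelRank_coe (h₁.trans (h₂.le.trans h₃))] at this ⊢
  omega

theorem IsTame.boxCount_coe_top (hf : IsTame F k f) {a₁ a₂ b : ℝ} (h₁ : a₁ ≤ a₂) (h₂ : a₂ < b) :
    (boxCount (sublevelRank F k f) (a₁, a₂) (b, ⊤) : ℤ) =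
      (betti F k f a₂ b : ℤ) - betti F k f a₁ b := by
  have := hf.isRankFunction.box (EReal.coe_le_coe_iff.2 h₁) (EReal.coe_lt_coe_iff.2 h₂) le_top
  unfold boxCount
  rw [hf.isRankFunction.top, hf.isRankFunction.top, sublevelRank_coe h₂.le,
    sublevelRank_coe (h₁.trans h₂.le)] at this ⊢
  omega

theorem IsTame.mult_coe (hf : IsTame F k f) {a b : ℝ} (hab : a < b) :
    mult (sublevelRank F k f) a b = properMult F k f a b := by
  have hS : {ε : ℝ | 0 < ε ∧ a + ε < b - ε} ∈ 𝓝[>] 0 := by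
    filter_upwards [Ioo_mem_nhdsGT (show (0 : ℝ) < (b - a) / 2 by linarith)] with ε hε
    exact ⟨hε.1, by linarith [hε.2]⟩
  rw [hf.isRankFunction.mult_eq_sInf (EReal.coe_lt_coe_iff.2 hab) hS (tendsto_coe_around a)
    (tendsto_coe_around b), properMult]
  · congr 1
    ext m
    simp only [mem_image, mem_ofPred_eq, and_assoc]
    refine exists_congr fun ε => and_congr_right fun hε => and_congr_right fun hlt => ?_
    rw [← hf.boxCount_coe (by linarith) hlt (by linarith), Nat.cast_inj, eq_comm]
  · rintro ε ⟨hε, hlt⟩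
    refine ⟨⟨.inr ?_, .inr ?_⟩, ⟨.inr ?_, .inr ?_⟩, ?_⟩ <;>
      exact EReal.coe_lt_coe_iff.2 (by linarith)

theorem IsTame.mult_coe_top (hf : IsTame F k f) (a : ℝ) :
    mult (sublevelRank F k f) a ⊤ = essentialMult F k f a := by
  have hS : {x : ℝ × ℝ | 0 < x.1 ∧ a + x.1 < x.2} ∈ 𝓝[>] 0 ×ˢ atTop := by
    filter_upwards [prod_mem_prod (Ioo_mem_nhdsGT one_pos) (Ici_mem_atTop (a + 1))] with x hx
    exact ⟨hx.1.1, by linarith [hx.1.2, mem_Ici.1 hx.2]⟩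
  rw [hf.isRankFunction.mult_eq_sInf (EReal.coe_lt_top a) hS
    ((tendsto_coe_around a).comp tendsto_fst) (tendsto_coe_around_top.comp tendsto_snd),
    essentialMult]
  · congr 1
    ext m
    simp only [mem_image, mem_ofPred_eq, Prod.exists, and_assoc]
    refine exists₂_congr fun ε c => and_congr_right fun hε => and_congr_right fun hlt => ?_
    simp only [Function.comp_apply]
    rw [← hf.boxCount_coe_top (by linarith) hlt, Nat.cast_inj, eq_comm]
  · rintro ⟨ε, c⟩ ⟨hε, hlt⟩
    refine ⟨⟨.inr ?_, .inr ?_⟩, ⟨.inr (EReal.coe_lt_top c), mem_insert _ _⟩, ?_⟩ <;>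
      exact EReal.coe_lt_coe_iff.2 (by linarith)

theorem IsTame.mult_bot [CompactSpace X] (hf : IsTame F k f) {b : EReal} (hb : ⊥ < b) :
    mult (sublevelRank F k f) ⊥ b = 0 := by
  obtain ⟨c, hc⟩ := (isCompact_range f.continuous).bddBelow
  have empty {a : EReal} (ha : a < c) : sublevelChain f a = sublevelChain f ⊥ := by
    refine (sublevelChain_le_sublevelChain (fun h => absurd h ha.ne_top) fun x hx => ?_).antisymm
      (sublevelChain_monotone f bot_le)
    exact absurd (hx.trans_lt ha) (EReal.coe_le_coe_iff.2 (hc (mem_range_self x))).not_gt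
  have zero {a : EReal} (ha : a < c) (d : EReal) : sublevelRank F k f a d = 0 := by
    rw [sublevelRank, chainRank, empty ha]
    exact hf.isRankFunction.bot d
  obtain ⟨⟨p, q⟩, hpq, hp⟩ := ((hf.isRankFunction.eventually_boxCount_eq hb).and
    (tendsto_fst.eventually ((eventually_mem_Icc_around ⊥).and
      ((tendsto_snd_around ⊥).eventually_lt_const (EReal.bot_lt_coe c))))).exists
  rw [← hpq, boxCount, zero hp.2, zero ((hp.1.1.trans hp.1.2).trans_lt hp.2), Nat.zero_sub]

end Multiplicity

section Diagram

/-- The diagram `D` consists of the bars of the rank function `r`, with the diagonal added. -/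
structure Diagram.Represents (D : Diagram) (r : EReal → EReal → ℕ) : Prop where
  proper : ∀ a b hab, D (.proper a b hab) = mult r a b
  essential : ∀ a, D (.essential a) = mult r a ⊤
  diag : D .diag = ⊤
  mult_bot : ∀ b, ⊥ < b → mult r ⊥ b = 0

theorem IsTame.represents_dgm {X : Type u} [TopologicalSpace X] [CompactSpace X] {F : Type v}
    [Field F] {k : ℤ} {f : C(X, ℝ)} (hf : IsTame F k f) :
    (dgm F k f).Represents (sublevelRank F k f) where
  proper _ _ hab := congrArg Nat.cast (hf.mult_coe hab).symm
  essential a := congrArg Nat.cast (hf.mult_coe_top a).symm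
  diag := rfl
  mult_bot _ := hf.mult_bot

namespace Diagram.Represents

variable {D : Diagram} {r : EReal → EReal → ℕ}

/-- An element of a diagram as a bar of the rank function or a copy of the diagonal. -/
noncomputable def toSum (h : D.Represents r) : D.Elem → Bar r ⊕ ℕ
  | ⟨(.proper a b hab, i), hi⟩ => .inl ⟨((a, b), i), EReal.coe_lt_coe_iff.2 hab, by
      simpa [h.proper] using hi⟩
  | ⟨(.essential a, i), hi⟩ => .inl ⟨((a, ⊤), i), EReal.coe_lt_top a, by
      simpa [h.essential] using hi⟩
  | ⟨(.diag, i), _⟩ => .inr i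

theorem toSum_injective (h : D.Represents r) : Function.Injective h.toSum := by
  rintro ⟨⟨_ | _ | _, i⟩, hi⟩ ⟨⟨_ | _ | _, j⟩, hj⟩ e <;>
    simp only [toSum, Sum.inl.injEq, Sum.inr.injEq, Subtype.mk.injEq, Prod.mk.injEq,
      EReal.coe_eq_coe_iff, EReal.coe_ne_top, EReal.top_ne_coe, and_true, and_false, false_and,
      reduceCtorEq] at e <;>
    simp [e]

theorem toSum_surjective (h : D.Represents r) : Function.Surjective h.toSum := by
  rintro (⟨⟨⟨a, b⟩, i⟩, hab, hi⟩ | i)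
  · have ha : a ≠ ⊥ := by
      rintro rfl
      exact absurd (hi.trans_eq (h.mult_bot b hab)) (Nat.not_lt_zero i)
    lift a to ℝ using ⟨hab.ne_top, ha⟩
    induction b with
    | bot => exact absurd hab not_lt_bot
    | top => exact ⟨⟨(.essential a, i), by simpa [h.essential] using hi⟩, rfl⟩
    | coe b =>
      exact ⟨⟨(.proper a b (EReal.coe_lt_coe_iff.1 hab), i), by simpa [h.proper] using hi⟩, rfl⟩
  · exact ⟨⟨(.diag, i), by simp [h.diag]⟩, rfl⟩

end Diagram.Represents

/-- Translation of the extended reals by a real number. -/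
noncomputable def translation (δ : ℝ) : EReal ≃o EReal where
  toFun x := x + δ
  invFun x := x - δ
  left_inv _ := EReal.add_sub_cancel_right
  right_inv _ := EReal.sub_add_cancel
  map_rel_iff' := (EReal.addLECancellable_coe δ).add_le_add_iff_right

theorem translation_coe (δ x : ℝ) : translation δ x = ((x + δ : ℝ) : EReal) := rfl

theorem le_translation {δ : ℝ} (hδ : 0 ≤ δ) (x : EReal) : x ≤ translation δ x :=
  le_add_of_nonneg_right (EReal.coe_nonneg.2 hδ)

namespace Diagram.Represents

variable {D E : Diagram} {r s : EReal → EReal → ℕ} {δ : ℝ}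

theorem d_le_of_close (hD : D.Represents r) (hE : E.Represents s) {p : D.Elem} {q : E.Elem}
    {P : Bar r} {Q : Bar s} (hp : hD.toSum p = .inl P) (hq : hE.toSum q = .inl Q)
    (h : P.birth ≤ translation δ Q.birth ∧ Q.birth ≤ translation δ P.birth ∧
      P.death ≤ translation δ Q.death ∧ Q.death ≤ translation δ P.death) :
    p.1.1.d q.1.1 ≤ ENNReal.ofReal δ := by
  have abs_sub_le {x y : ℝ} (h₁ : x ≤ y + δ) (h₂ : y ≤ x + δ) : |x - y| ≤ δ :=
    abs_sub_le_iff.2 ⟨sub_le_iff_le_add'.2 h₁, sub_le_iff_le_add'.2 h₂⟩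
  obtain ⟨⟨_ | _ | _, i⟩, hi⟩ := p <;> obtain ⟨⟨_ | _ | _, j⟩, hj⟩ := q <;>
    simp only [toSum, Sum.inl.injEq, reduceCtorEq] at hp hq <;> subst hp hq <;>
    simp only [Bar.birth, Bar.death, translation_coe, EReal.coe_le_coe_iff, top_le_iff,
      EReal.coe_ne_top, and_false, false_and] at h <;>
    obtain ⟨birth, birth', death⟩ := h
  · exact ENNReal.ofReal_le_ofReal (min_le_of_left_le
      (max_le (abs_sub_le birth birth') (abs_sub_le death.1 death.2)))
  · exact ENNReal.ofReal_le_ofReal (abs_sub_le birth birth')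

theorem d_le_of_short (hD : D.Represents r) (hE : E.Represents s) {p : D.Elem} {q : E.Elem}
    (hp : ∀ P, hD.toSum p = .inl P → P.death ≤ translation δ (translation δ P.birth))
    (hq : ∀ Q, hE.toSum q = .inl Q → Q.death ≤ translation δ (translation δ Q.birth)) :
    p.1.1.d q.1.1 ≤ ENNReal.ofReal δ := by
  obtain ⟨⟨_ | _ | _, i⟩, hi⟩ := p <;> obtain ⟨⟨_ | _ | _, j⟩, hj⟩ := q <;>
    simp only [toSum, Sum.inl.injEq, reduceCtorEq, forall_eq', Bar.birth, Bar.death,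
      translation_coe, EReal.coe_le_coe_iff, top_le_iff, EReal.coe_ne_top] at hp hq
  · refine ENNReal.ofReal_le_ofReal (min_le_of_right_le (max_le ?_ ?_)) <;> linarith
  · exact ENNReal.ofReal_le_ofReal (by linarith)
  · exact ENNReal.ofReal_le_ofReal (by linarith)
  · exact zero_le

end Diagram.Represents

theorem exists_equiv_apply_eq {α β γ : Type*} [Countable α] [Countable β] {f : γ → α} {g : γ → β}
    (hf : Function.Injective f) (hg : Function.Injective g) [Infinite ↥(range f)ᶜ]
    [Infinite ↥(range g)ᶜ] : ∃ σ : α ≃ β, ∀ c, σ (f c) = g c := by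
  let h : range f ↪ β := (Equiv.ofInjective f hf).symm.toEmbedding.trans ⟨g, hg⟩
  have range : range h = range g :=
    (Equiv.ofInjective f hf).symm.surjective.range_comp g
  obtain ⟨σ, hσ⟩ := Cardinal.extend_function h (range ▸ nonempty_equiv_of_countable)
  exact ⟨σ, fun c => (hσ ⟨f c, c, rfl⟩).trans
    (congrArg g (Equiv.ofInjective_symm_apply hf c))⟩

theorem infinite_compl_range_inl {α γ : Type*} (f : γ → α) :
    Infinite ↥(range fun c => (.inl (f c) : α ⊕ ℕ))ᶜ :=
  .of_injective (fun n : ℕ => ⟨.inr n, by simp⟩) fun m n h => by simpa using h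

theorem exists_equiv_sum_nat {α β γ : Type*} [Countable α] [Countable β] {f : γ → α} {g : γ → β}
    (hf : Function.Injective f) (hg : Function.Injective g) :
    ∃ σ : α ⊕ ℕ ≃ β ⊕ ℕ, ∀ c, σ (.inl (f c)) = .inl (g c) :=
  have := infinite_compl_range_inl f
  have := infinite_compl_range_inl g
  exists_equiv_apply_eq (Sum.inl_injective.comp hf) (Sum.inl_injective.comp hg)

theorem Diagram.Represents.bottleneck_le {D E : Diagram} {r s t : EReal → EReal → ℕ} {δ : ℝ}
    (hD : D.Represents r) (hE : E.Represents s) (hr : IsRankFunction r) (hs : IsRankFunction s)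
    (ht : IsRankFunction t) (hδ : 0 ≤ δ) (h : IsInterpolant r s t (translation δ)) :
    bottleneck D E ≤ ENNReal.ofReal δ := by
  obtain ⟨ι₁, ι₂, inj₁, inj₂, close, long₁, long₂⟩ :=
    exists_matching h hr hs ht (le_translation hδ)
  have := hr.countable_bar
  have := hs.countable_bar
  obtain ⟨σ, hσ⟩ := exists_equiv_sum_nat inj₁ inj₂
  let Φ := Equiv.ofBijective _ ⟨hD.toSum_injective, hD.toSum_surjective⟩
  let Ψ := Equiv.ofBijective _ ⟨hE.toSum_injective, hE.toSum_surjective⟩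
  refine iInf_le_of_le ((Φ.trans σ).trans Ψ.symm) (iSup_le fun p => ?_)
  have hq : hE.toSum (((Φ.trans σ).trans Ψ.symm) p) = σ (hD.toSum p) := Ψ.apply_symm_apply _
  by_cases hp : ∃ c, hD.toSum p = .inl (ι₁ c)
  · obtain ⟨c, hc⟩ := hp
    exact hD.d_le_of_close hE hc (by rw [hq, hc, hσ]) (close c)
  · refine hD.d_le_of_short hE (fun P hP => not_lt.1 fun hlt => ?_)
      fun Q hQ => not_lt.1 fun hlt => ?_
    · obtain ⟨c, rfl⟩ := long₁ P hlt
      exact hp ⟨c, hP⟩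
    · obtain ⟨c, rfl⟩ := long₂ Q hlt
      exact hp ⟨c, σ.injective ((hq.symm.trans hQ).trans (hσ c).symm)⟩

end Diagram

section BottleneckMetric

/-- The distance from a point to the diagonal; an infinite bar is infinitely far away. -/
noncomputable def Point.diagDist : Point → ℝ≥0∞
  | .proper a b _ => ENNReal.ofReal ((b - a) / 2)
  | .essential _ => ⊤
  | .diag => 0

/-- The `ℓ^∞` distance between two bars, infinite between points of different kinds. -/
noncomputable def Point.directDist : Point → Point → ℝ≥0∞
  | .proper a b _, .proper a' b' _ => edist (a, b) (a', b')
  | .essential a, .essential a' => edist a a'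
  | .diag, .diag => 0
  | _, _ => ⊤

theorem Point.directDist_self (p : Point) : p.directDist p = 0 := by
  cases p <;> simp [directDist]

theorem Point.directDist_comm (p q : Point) : p.directDist q = q.directDist p := by
  cases p <;> cases q <;> simp [directDist, edist_comm]

theorem Point.directDist_triangle (p q r : Point) :
    p.directDist r ≤ p.directDist q + q.directDist r := by
  cases p <;> cases q <;> cases r <;> simp only [directDist, top_add, add_top, le_top, zero_le] <;>
    exact edist_triangle _ _ _

theorem Point.diagDist_le (p q : Point) : p.diagDist ≤ p.directDist q + q.diagDist := by
  rcases p with ⟨a, b, hab⟩ | a | _ <;> rcases q with ⟨a', b', hab'⟩ | a' | _ <;>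
    simp only [diagDist, directDist, top_add, add_top, le_top, zero_le]
  rw [edist_dist, ← ENNReal.ofReal_add dist_nonneg (by linarith), Prod.dist_eq, Real.dist_eq,
    Real.dist_eq]
  refine ENNReal.ofReal_le_ofReal ?_
  linarith [le_max_left |a - a'| |b - b'|, le_max_right |a - a'| |b - b'|, neg_abs_le (a - a'),
    le_abs_self (b - b')]

theorem Point.d_eq_min (p q : Point) :
    p.d q = min (p.directDist q) (max p.diagDist q.diagDist) := by
  rcases p with ⟨a, b, hab⟩ | a | _ <;> rcases q with ⟨a', b', hab'⟩ | a' | _ <;>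
    simp only [d, diagDist, directDist, edist_dist, Prod.dist_eq, Real.dist_eq, ENNReal.ofReal_min,
      ENNReal.ofReal_max, max_top_left, max_top_right, min_top_left, min_top_right, max_self,
      min_self, max_eq_left zero_le, max_eq_right zero_le]

theorem Point.d_self (p : Point) : p.d p = 0 := by
  rw [d_eq_min, directDist_self]
  exact min_eq_left zero_le

theorem Point.d_comm (p q : Point) : p.d q = q.d p := by
  rw [d_eq_min, d_eq_min, directDist_comm, max_comm]

theorem min_max_triangle {e₁₂ e₂₃ e₁₃ h₁ h₂ h₃ : ℝ≥0∞} (he : e₁₃ ≤ e₁₂ + e₂₃)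
    (h₁₂ : h₁ ≤ e₁₂ + h₂) (h₃₂ : h₃ ≤ e₂₃ + h₂) :
    min e₁₃ (max h₁ h₃) ≤ min e₁₂ (max h₁ h₂) + min e₂₃ (max h₂ h₃) := by
  rw [min_add, add_min, add_min]
  refine le_min (le_min (min_le_of_left_le he) ?_) (le_min ?_ ?_) <;>
    refine min_le_of_right_le (max_le ?_ ?_)
  · exact h₁₂.trans (by gcongr; exact le_max_left _ _)
  · exact le_add_left (le_max_right _ _)
  · exact le_add_right (le_max_left _ _)
  · exact h₃₂.trans (by rw [add_comm]; gcongr; exact le_max_right _ _)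
  · exact le_add_right (le_max_left _ _)
  · exact le_add_left (le_max_right _ _)

theorem Point.d_triangle (p q r : Point) : p.d r ≤ p.d q + q.d r := by
  simp only [d_eq_min]
  exact min_max_triangle (p.directDist_triangle q r) (p.diagDist_le q)
    (q.directDist_comm r ▸ r.diagDist_le q)

theorem bottleneck_self (D : Diagram) : bottleneck D D = 0 :=
  nonpos_iff_eq_zero.1 <| iInf_le_of_le (Equiv.refl _) <| iSup_le fun p => (Point.d_self p.1.1).le

theorem bottleneck_comm (D E : Diagram) : bottleneck D E = bottleneck E D := by
  refine (Equiv.symmEquiv _ _).iInf_congr fun σ => ?_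
  refine (σ.symm.iSup_congr fun q => ?_)
  simp [Point.d_comm]

theorem bottleneck_triangle (D E G : Diagram) :
    bottleneck D G ≤ bottleneck D E + bottleneck E G := by
  refine ENNReal.le_iInf_add_iInf fun σ τ => iInf_le_of_le (σ.trans τ) (iSup_le fun p => ?_)
  exact (Point.d_triangle _ (σ p).1.1 _).trans (add_le_add
    (le_iSup (fun p : D.Elem => Point.d p.1.1 (σ p).1.1) p)
    (le_iSup (fun q : E.Elem => Point.d q.1.1 (τ q).1.1) (σ p)))

end BottleneckMetric

section Stability

variable {X : Type u} [TopologicalSpace X] {F : Type v} [Field F] {k : ℤ}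

theorem sublevelChain_le_translation [CompactSpace X] (f g : C(X, ℝ)) (a : EReal) :
    sublevelChain f a ≤ sublevelChain g (translation (dist f g) a) := by
  refine sublevelChain_le_sublevelChain_orderIso (fun x => EReal.coe_le_coe_iff.2 ?_) a
  have close : |f x - g x| ≤ dist f g :=
    (Real.dist_eq _ _).symm.trans_le (ContinuousMap.dist_apply_le_dist x)
  linarith [neg_abs_le (f x - g x)]

theorem IsTame.bottleneck_dgm_le [CompactSpace X] {f g : C(X, ℝ)} (hf : IsTame F k f)
    (hg : IsTame F k g) : bottleneck (dgm F k f) (dgm F k g) ≤ edist f g := by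
  have hfg := sublevelChain_le_translation f g
  have hgf := sublevelChain_le_translation g f
  rw [dist_comm] at hgf
  rw [edist_dist]
  exact hf.represents_dgm.bottleneck_le hg.represents_dgm hf.isRankFunction hg.isRankFunction
    (hf.isTameChain.isRankFunction_shift hg.isTameChain hfg) dist_nonneg
    (hf.isTameChain.isInterpolant hg.isTameChain hfg hgf)

variable (F k X) in
theorem continuous_bottleneck_dgm [CompactSpace X] :
    Continuous fun p : {f : C(X, ℝ) // IsTame F k f} × {f : C(X, ℝ) // IsTame F k f} =>
      bottleneck (dgm F k p.1.1) (dgm F k p.2.1) := by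
  refine continuous_of_le_add_edist 2 (by finiteness) fun ⟨f, g⟩ ⟨f', g'⟩ => ?_
  calc bottleneck (dgm F k f.1) (dgm F k g.1)
      ≤ bottleneck (dgm F k f.1) (dgm F k f'.1) + (bottleneck (dgm F k f'.1) (dgm F k g'.1) +
          bottleneck (dgm F k g'.1) (dgm F k g.1)) :=
        (bottleneck_triangle _ (dgm F k f'.1) _).trans
          (add_le_add_right (bottleneck_triangle _ (dgm F k g'.1) _) _)
    _ ≤ edist (f, g) (f', g') + (bottleneck (dgm F k f'.1) (dgm F k g'.1) +
          edist (f, g) (f', g')) := by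
        gcongr
        · exact (f.2.bottleneck_dgm_le f'.2).trans (le_max_left _ _)
        · rw [bottleneck_comm]
          exact (g.2.bottleneck_dgm_le g'.2).trans (le_max_right _ _)
    _ = bottleneck (dgm F k f'.1) (dgm F k g'.1) + 2 * edist (f, g) (f', g') := by ring

end Stability

section ConvexMatchingDistance

variable {X : Type u} [TopologicalSpace X] {F : Type v} [Field F] {k : ℤ}

theorem cmd_nonneg (φ ψ : C(X, ℝ × ℝ)) : 0 ≤ cmd F k φ ψ :=
  Real.sSup_nonneg (forall_mem_image.2 fun _ _ => ENNReal.toReal_nonneg)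

theorem cmd_comm (φ ψ : C(X, ℝ × ℝ)) : cmd F k φ ψ = cmd F k ψ φ := by
  simp only [cmd, sliceDist, bottleneck_comm (dgm F k (convexComb φ _))]

theorem cmd_eq_zero {φ ψ : C(X, ℝ × ℝ)}
    (h : ∀ t, dgm F k (convexComb φ t) = dgm F k (convexComb ψ t)) : cmd F k φ ψ = 0 := by
  simp only [cmd, sliceDist, h, bottleneck_self, ENNReal.toReal_zero]
  rw [(nonempty_Icc.2 zero_le_one).image_const, csSup_singleton]

theorem continuous_convexComb (φ : C(X, ℝ × ℝ)) : Continuous (convexComb φ) := by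
  have : convexComb φ = fun t : ℝ =>
      AffineMap.lineMap (ContinuousMap.fst.comp φ) (ContinuousMap.snd.comp φ) t := by
    ext t x
    simp [convexComb, AffineMap.lineMap_apply_module]
  rw [this]
  exact AffineMap.lineMap_continuous

variable [CompactSpace X] {φ ξ ψ : C(X, ℝ × ℝ)}

theorem IsAdmissible.sliceDist_ne_top (hφ : IsAdmissible F k φ) (hψ : IsAdmissible F k ψ) {t : ℝ}
    (ht : t ∈ Icc (0 : ℝ) 1) : sliceDist F k φ ψ t ≠ ⊤ :=
  ne_top_of_le_ne_top (edist_ne_top _ _) ((hφ t ht).bottleneck_dgm_le (hψ t ht))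

theorem IsAdmissible.continuousOn_sliceDist (hφ : IsAdmissible F k φ) (hψ : IsAdmissible F k ψ) :
    ContinuousOn (sliceDist F k φ ψ) (Icc 0 1) := by
  have slice {χ : C(X, ℝ × ℝ)} (hχ : IsAdmissible F k χ) :
      Continuous fun t : Icc (0 : ℝ) 1 =>
        (⟨convexComb χ t, hχ t t.2⟩ : {f : C(X, ℝ) // IsTame F k f}) :=
    ((continuous_convexComb χ).comp continuous_subtype_val).subtype_mk _
  have := (continuous_bottleneck_dgm X F k).comp ((slice hφ).prodMk (slice hψ))
  exact continuousOn_iff_continuous_domRestrict.2 this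

theorem IsAdmissible.isGreatest_cmd (hφ : IsAdmissible F k φ) (hψ : IsAdmissible F k ψ) :
    IsGreatest ((fun t : ℝ => (sliceDist F k φ ψ t).toReal) '' Icc 0 1) (cmd F k φ ψ) := by
  have continuousOn : ContinuousOn (fun t : ℝ => (sliceDist F k φ ψ t).toReal) (Icc 0 1) :=
    ENNReal.continuousOn_toReal.comp (hφ.continuousOn_sliceDist hψ) fun _ =>
      hφ.sliceDist_ne_top hψ
  exact (isCompact_Icc.image_of_continuousOn continuousOn).isGreatest_sSup
    ((nonempty_Icc.2 zero_le_one).image _)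

theorem IsAdmissible.cmd_triangle (hφ : IsAdmissible F k φ) (hξ : IsAdmissible F k ξ)
    (hψ : IsAdmissible F k ψ) : cmd F k φ ψ ≤ cmd F k φ ξ + cmd F k ξ ψ := by
  refine (isLUB_le_iff (hφ.isGreatest_cmd hψ).isLUB).2 (forall_mem_image.2 fun t ht => ?_)
  calc (sliceDist F k φ ψ t).toReal
      ≤ (sliceDist F k φ ξ t + sliceDist F k ξ ψ t).toReal :=
        ENNReal.toReal_mono (ENNReal.add_ne_top.2
          ⟨hφ.sliceDist_ne_top hξ ht, hξ.sliceDist_ne_top hψ ht⟩) (bottleneck_triangle _ _ _)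
    _ = (sliceDist F k φ ξ t).toReal + (sliceDist F k ξ ψ t).toReal :=
        ENNReal.toReal_add (hφ.sliceDist_ne_top hξ ht) (hξ.sliceDist_ne_top hψ ht)
    _ ≤ cmd F k φ ξ + cmd F k ξ ψ :=
        add_le_add ((hφ.isGreatest_cmd hξ).2 ⟨t, ht, rfl⟩) ((hξ.isGreatest_cmd hψ).2 ⟨t, ht, rfl⟩)

end ConvexMatchingDistance

section Homeomorphism

variable {X Y : Type u} [TopologicalSpace X] [TopologicalSpace Y] (F : Type v) [Field F] (k : ℤ)

/-- The homeomorphism between corresponding sublevel sets of `f ∘ h` and `f`. -/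
def sublevelIso (h : X ≃ₜ Y) (f : C(Y, ℝ)) (a : ℝ) :
    sublevel (f.comp (h : C(X, Y))) a ≅ sublevel f a :=
  TopCat.isoOfHomeo (h.subtype fun _ => Iff.rfl)

/-- The isomorphism on homology between corresponding sublevel sets of `f ∘ h` and `f`. -/
noncomputable def homologySublevelEquiv (h : X ≃ₜ Y) (f : C(Y, ℝ)) (a : ℝ) :
    (homologyFunctor.{u, v} F k).obj (sublevel (f.comp (h : C(X, Y))) a) ≃ₗ[F]
      (homologyFunctor.{u, v} F k).obj (sublevel f a) :=
  ((homologyFunctor.{u, v} F k).mapIso (sublevelIso h f a)).toLinearEquiv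

theorem map_persistentHomology (h : X ≃ₜ Y) (f : C(Y, ℝ)) {a b : ℝ} (hab : a ≤ b) :
    (persistentHomology F k (f.comp (h : C(X, Y))) hab).map
      (homologySublevelEquiv F k h f b : _ →ₗ[F] _) = persistentHomology F k f hab := by
  have natural : sublevelIncl (f.comp (h : C(X, Y))) hab ≫ (sublevelIso h f b).hom =
      (sublevelIso h f a).hom ≫ sublevelIncl f hab := rfl
  have map_natural := congrArg ModuleCat.Hom.hom
    (congrArg (homologyFunctor.{u, v} F k).map natural)
  rw [Functor.map_comp, Functor.map_comp, ModuleCat.hom_comp, ModuleCat.hom_comp] at map_natural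
  rw [persistentHomology, ← LinearMap.range_comp]
  exact (congrArg LinearMap.range map_natural).trans
    (LinearMap.range_comp_of_range_eq_top _ (homologySublevelEquiv F k h f a).range)

theorem betti_comp_homeomorph (h : X ≃ₜ Y) (f : C(Y, ℝ)) (a b : ℝ) :
    betti F k (f.comp (h : C(X, Y))) a b = betti F k f a b := by
  unfold betti
  split_ifs with hab
  · rw [← map_persistentHomology F k h f hab]
    exact ((homologySublevelEquiv F k h f b).finrank_map_eq _).symm
  · rfl

theorem dgm_comp_homeomorph (h : X ≃ₜ Y) (f : C(Y, ℝ)) :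
    dgm F k (f.comp (h : C(X, Y))) = dgm F k f := by
  funext p
  cases p <;> simp only [dgm, properMult, essentialMult, betti_comp_homeomorph]

theorem cmd_comp_homeomorph (h : X ≃ₜ X) (φ : C(X, ℝ × ℝ)) :
    cmd F k (φ.comp (h : C(X, X))) φ = 0 :=
  cmd_eq_zero fun t => dgm_comp_homeomorph F k h (convexComb φ t)

end Homeomorphism

section FiniteSpace

variable {X : Type u} [TopologicalSpace X] [Finite X] [TotallyDisconnectedSpace X] (F : Type v)
  [Field F] (k : ℤ)

theorem isTame_of_finite (f : C(X, ℝ)) : IsTame F k f := by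
  intro a b hab
  have : Finite (sublevel f a) := inferInstanceAs (Finite {x : X // f x ≤ a})
  have : TotallyDisconnectedSpace (sublevel f a) :=
    inferInstanceAs (TotallyDisconnectedSpace {x : X // f x ≤ a})
  have := finite_homology F k (sublevel f a)
  exact inferInstanceAs (Module.Finite F (LinearMap.range _))

theorem isAdmissible_of_finite (φ : C(X, ℝ × ℝ)) : IsAdmissible F k φ :=
  fun _ _ => isTame_of_finite F k _

theorem exists_comp_homeomorph_ne : ∃ (φ : C(ULift.{u} Bool, ℝ × ℝ))
    (h : ULift.{u} Bool ≃ₜ ULift.{u} Bool),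
    φ.comp (h : C(ULift.{u} Bool, ULift.{u} Bool)) ≠ φ := by
  refine ⟨⟨fun x => if x.down then (1, 1) else (0, 0), continuous_of_discreteTopology⟩,
    (Equiv.ulift.trans (Equiv.boolNot.trans Equiv.ulift.symm)).toHomeomorphOfDiscrete,
    fun e => ?_⟩
  have : ((0, 0) : ℝ × ℝ) = (1, 1) := DFunLike.congr_fun e ⟨true⟩
  exact zero_ne_one (congrArg Prod.fst this)

theorem exists_cmd_eq_zero :
    ∃ (X : Type u) (_ : TopologicalSpace X) (_ : CompactSpace X) (φ ψ : C(X, ℝ × ℝ)),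
      IsAdmissible F k φ ∧ IsAdmissible F k ψ ∧ φ ≠ ψ ∧ cmd F k φ ψ = 0 := by
  obtain ⟨φ, h, hne⟩ := exists_comp_homeomorph_ne
  exact ⟨ULift.{u} Bool, inferInstance, inferInstance, _, φ, isAdmissible_of_finite F k _,
    isAdmissible_of_finite F k φ, hne, cmd_comp_homeomorph F k h φ⟩

end FiniteSpace

end ConvexMatching

open ConvexMatching in
theorem proposition1 (F : Type v) [Field F] (k : ℤ) :
    (∀ (X : Type u) [TopologicalSpace X] [CompactSpace X],
      (∀ φ ψ : C(X, ℝ × ℝ), IsAdmissible F k φ → IsAdmissible F k ψ →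
        (∀ t ∈ Set.Icc (0 : ℝ) 1, sliceDist F k φ ψ t ≠ ⊤) ∧
        IsGreatest ((fun t : ℝ => (sliceDist F k φ ψ t).toReal) '' Set.Icc 0 1) (cmd F k φ ψ) ∧
        0 ≤ cmd F k φ ψ ∧
        cmd F k φ ψ = cmd F k ψ φ) ∧
      (∀ φ : C(X, ℝ × ℝ), IsAdmissible F k φ → cmd F k φ φ = 0) ∧
      (∀ φ ξ ψ : C(X, ℝ × ℝ), IsAdmissible F k φ → IsAdmissible F k ξ → IsAdmissible F k ψ →
        cmd F k φ ψ ≤ cmd F k φ ξ + cmd F k ξ ψ)) ∧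
    (∃ (X : Type u) (_ : TopologicalSpace X) (_ : CompactSpace X) (φ ψ : C(X, ℝ × ℝ)),
      IsAdmissible F k φ ∧ IsAdmissible F k ψ ∧ φ ≠ ψ ∧ cmd F k φ ψ = 0) :=
  ⟨fun _ _ _ =>
    ⟨fun φ ψ hφ hψ => ⟨fun _ ht => hφ.sliceDist_ne_top hψ ht, hφ.isGreatest_cmd hψ,
        cmd_nonneg φ ψ, cmd_comm φ ψ⟩,
      fun _ _ => cmd_eq_zero fun _ => rfl,
      fun _ _ _ hφ hξ hψ => hφ.cmd_triangle hξ hψ⟩,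
    exists_cmd_eq_zero F k⟩
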